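/- Let $(M,\omega)$ and $(\bar M,\bar\omega)$ be symplectic manifolds of dimension $2n$, let $H:M\to\mathbb R$ and $\bar H:\bar M\to\mathbb R$ be smooth functions, and let $v$, $\bar v$ be their Hamiltonian vector fields, $\omega(v,\cdot)=-dH$ and $\bar\omega(\bar v,\cdot)=-d\bar H$. Let $h$, $\bar h$ be regular values of $H$, $\bar H$, and put $Q=\{H=h\}$, $\bar Q=\{\bar H=\bar h\}$. Let $\Phi:U(Q)\to U(\bar Q)$ be a diffeomorphism between (open) neighbourhoods of $Q$ and $\bar Q$ such that $\Phi(Q)=\bar Q$ and such that $\Phi|_Q$ takes the trajectories of $v$ on $Q$ to trajectories of $\bar v$. Then there are (unique) functions $a_1,a_2:Q\to\mathbb R$ such that at every $x\in Q$ $$d\Phi_x(v(x))=a_1(x)\,\bar v(\Phi(x)),\qquad d\bar H_{\Phi(x)}\circ d\Phi_x=a_2(x)\,dH_x .$$ Put $a=a_1a_2$. At every $x\in Q$ the function $$\mathcal P_x(t)=\frac{\operatorname{Pf}(\Phi^*\bar\omega-t\,\omega)_x}{\operatorname{Pf}(\omega)_x\,(t-a(x))},$$ where the Pfaffians are those of the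 matrices of the two forms in any one basis of $T_xM$, does not depend on the basis and is a polynomial in $t$ of degree $n-1$ (so it is also defined at $t=a(x)$). For every $t\in\mathbb R$ the function $x\mapsto\mathcal P_x(t)$ is an integral of $v$ on $Q$, that is, a smooth function on $Q$ that is constant along the trajectories of $v$. In particular, all coefficients of the polynomial $\mathcal P_x$ are integrals of $v$ on $Q$. -/

import Mathlib

open Set
open scoped Manifold ContDiff Topology

noncomputable section

/-- The Pfaffian of a `2n × 2n` matrix (meaningful for skew-symmetric ones):
`(1 / (2ⁿ n!)) ∑_σ sign σ ∏_{i < n} A (σ (2i)) (σ (2i+1))`. -/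
def pfaffian {n : ℕ} (A : Matrix (Fin (2 * n)) (Fin (2 * n)) ℝ) : ℝ :=
  ((2 : ℝ) ^ n * (n.factorial : ℝ))⁻¹ *
    ∑ σ : Equiv.Perm (Fin (2 * n)), ((Equiv.Perm.sign σ : ℤ) : ℝ) *
      ∏ i : Fin n, A (σ ⟨2 * i.1, by omega⟩) (σ ⟨2 * i.1 + 1, by omega⟩)

/-- The Gram matrix `η(b i, b j)` of a two-form `η` in a basis `b`. -/
def gramMatrix {n : ℕ} {V : Type*} [AddCommGroup V] [Module ℝ V] [TopologicalSpace V]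
    (b : Module.Basis (Fin (2 * n)) ℝ V) (η : V [⋀^Fin 2]→L[ℝ] ℝ) :
    Matrix (Fin (2 * n)) (Fin (2 * n)) ℝ :=
  Matrix.of fun i j => η ![b i, b j]

/-- A (not necessarily smooth) field of two-forms on a manifold of dimension `d`. -/
abbrev TwoForm (d : ℕ) (M : Type*) [TopologicalSpace M]
    [ChartedSpace (EuclideanSpace ℝ (Fin d)) M] : Type _ :=
  ∀ x : M, TangentSpace (𝓡 d) x [⋀^Fin 2]→L[ℝ] ℝ

section Manifold

variable {d : ℕ} {M : Type*} [TopologicalSpace M] [ChartedSpace (EuclideanSpace ℝ (Fin d)) M]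

/-- The coordinate expression of a two-form in the preferred chart at `x₀`: its pullback under the
inverse of that chart. It is used only on the (open) target of the chart. -/
def TwoForm.inChart (Ω : TwoForm d M) (x₀ : M) :
    EuclideanSpace ℝ (Fin d) → EuclideanSpace ℝ (Fin d) [⋀^Fin 2]→L[ℝ] ℝ :=
  fun y => (Ω ((extChartAt (𝓡 d) x₀).symm y)).compContinuousLinearMap
    (mfderiv (𝓡 d) (𝓡 d) (extChartAt (𝓡 d) x₀).symm y)

/-- A symplectic form: a smooth, closed, nondegenerate two-form. -/
structure IsSymplecticForm (Ω : TwoForm d M) : Prop where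
  smooth : ∀ x₀ : M, ContDiffOn ℝ ∞ (Ω.inChart x₀) (extChartAt (𝓡 d) x₀).target
  closed : ∀ x₀ : M, ∀ y ∈ (extChartAt (𝓡 d) x₀).target, extDeriv (Ω.inChart x₀) y = 0
  nondegenerate : ∀ (x : M) (u : TangentSpace (𝓡 d) x),
    (∀ w : TangentSpace (𝓡 d) x, Ω x ![u, w] = 0) → u = 0

/-- The differential `dH` at `x`, as a covector. -/
def differential (H : M → ℝ) (x : M) : TangentSpace (𝓡 d) x →L[ℝ] ℝ :=
  mfderiv (𝓡 d) 𝓘(ℝ) H x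

/-- `v` is the Hamiltonian vector field of `H` with respect to `Ω`: the smooth vector field with
`Ω(v, ·) = -dH`. -/
structure IsHamiltonianField [IsManifold (𝓡 d) ∞ M] (Ω : TwoForm d M) (H : M → ℝ)
    (v : ∀ x : M, TangentSpace (𝓡 d) x) : Prop where
  smooth : ContMDiff (𝓡 d) (𝓡 d).tangent ∞ (fun x => (⟨x, v x⟩ : TangentBundle (𝓡 d) M))
  eq : ∀ (x : M) (u : TangentSpace (𝓡 d) x), Ω x ![v x, u] = -differential (d := d) H x u

/-- The level set `{H = h}`. -/
def levelSet (H : M → ℝ) (h : ℝ) : Set M := {x | H x = h}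

variable (d) in
/-- `h` is a regular value of `H`. -/
def IsRegularValue (H : M → ℝ) (h : ℝ) : Prop :=
  ∀ x : M, H x = h → differential (d := d) H x ≠ 0

/-- The trajectory of `v` through `x`: all points reached from `x` along integral curves of `v`
defined on open intervals, that is, the image of the maximal integral curve through `x`. -/
def trajectory (v : ∀ x : M, TangentSpace (𝓡 d) x) (x : M) : Set M :=
  {y | ∃ (γ : ℝ → M) (α β s : ℝ), α < 0 ∧ 0 < β ∧ s ∈ Ioo α β ∧
    IsMIntegralCurveOn (I := 𝓡 d) γ v (Ioo α β) ∧ γ 0 = x ∧ γ s = y}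

/-- `f : Q → ℝ` is an integral of `v` on `Q`: it is smooth (near every point of `Q` it is the
restriction of a smooth function on the ambient manifold) and constant along the trajectories of
`v` lying on `Q`. -/
structure IsIntegralOn (v : ∀ x : M, TangentSpace (𝓡 d) x) (Q : Set M) (f : Q → ℝ) : Prop where
  smooth : ∀ x : Q, ∃ (U : Set M) (F : M → ℝ), IsOpen U ∧ x.1 ∈ U ∧
    ContMDiffOn (𝓡 d) 𝓘(ℝ) ∞ F U ∧ ∀ y : Q, y.1 ∈ U → F y.1 = f y
  const : ∀ x y : Q, y.1 ∈ trajectory v x.1 → f y = f x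

variable {N : Type*} [TopologicalSpace N] [ChartedSpace (EuclideanSpace ℝ (Fin d)) N]

/-- The pullback `Φ^* η` of a two-form. -/
def TwoForm.pullback (Φ : M → N) (η : TwoForm d N) : TwoForm d M :=
  fun x => (η (Φ x)).compContinuousLinearMap (mfderiv (𝓡 d) (𝓡 d) Φ x)

/-- `Φ` takes the trajectories of `v` on `Q` to trajectories of `w`. -/
def IsTrajectorialOn (Φ : M → N) (v : ∀ x : M, TangentSpace (𝓡 d) x)
    (w : ∀ y : N, TangentSpace (𝓡 d) y) (Q : Set M) : Prop :=
  ∀ x ∈ Q, Φ '' trajectory v x = trajectory w (Φ x)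

end Manifold

end

/-! Write τ = Ω and σ = Φ^*Ω'. The two proportionalities give ι_v τ = -dH and ι_v σ = -a dH on the
level set Q. Hence v lies in the radical of σ - aτ, and Pf(σ - tτ)/Pf(τ) vanishes at t = a. This
quotient is a polynomial of degree n in t, and it does not depend on the basis because the Pfaffian
of a form is a top-degree alternating function of the frame (`bilinPfaffian_eq_det_mul`). Dividing
by t - a leaves degree n - 1.

Invariance: let η be a closed two-form with ι_v η = c dH on Q. By Cartan's formula, L_v η restricted
to TQ is that of dc ∧ dH, which is zero (`lieDeriv_eq_zero_of_contraction`). Take a frame containing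
v, with all members but one, e, tangent to Q. The row of v in the Gram matrix is supported at the
single entry c dH(e), so Pf(η) is this entry times a quantity depending only on η restricted to TQ.
In a frame transported by the flow, dH(e) is constant to first order, so Pf(η) changes at the
logarithmic rate of c (`hasDerivAt_pfaffian_transportedFrame`). Comparing η = τ, c = -1 with η = σ -
tτ, c = t - a shows that Pf(σ - tτ)/(Pf(τ)(t - a)) has zero derivative along v
(`deriv_eq_zero_of_pfaffian_factorization`). This requires t ≠ a; since a polynomial is determined
by its values off one point, all coefficients are constant, and so are the values at every t.

Proportionality: a₂ is a Lagrange multiplier (`apply_eq_zero_of_eventually_level`). For a₁ only the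
images of trajectories are known to correspond, and a trajectory may accumulate on itself. A curve
transverse to v' would, however, meet a trajectory of v' at countably many parameters only, whereas
Φ ∘ γ stays in one throughout an interval (`exists_smul_eq_of_eventually_mem_trajectory`).

Smoothness: near a point of Q, a extends as -σ(v, w)/dH(w) with w a constant vector in a chart, and
the coefficients of the quotient are polynomials in a and in the coefficients of Pf(σ - tτ)/Pf(τ).
-/

noncomputable section

/-! ### Pfaffians of bilinear forms: change of frame, degeneracy, expansion along a row -/

section PfaffianForm

variable {n : ℕ} {V : Type*} [AddCommGroup V] [Module ℝ V]

/-- Replacing one entry of a family changes the product of pairings linearly. -/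
theorem exists_linear_prod_pairing_update (B : V →ₗ[ℝ] V →ₗ[ℝ] ℝ) (m : Fin (2 * n) → V)
    (k : Fin (2 * n)) : ∃ g : V →ₗ[ℝ] ℝ, ∀ z,
      ∏ i : Fin n, B (Function.update m k z ⟨2 * i.1, by omega⟩)
        (Function.update m k z ⟨2 * i.1 + 1, by omega⟩) = g z := by
  -- The index k occurs in the pair number k / 2 only, so every other factor is a constant.
  set i₀ : Fin n := ⟨k.1 / 2, by omega⟩ with hi₀
  have hrest : ∀ z, ∏ i ∈ {i₀}ᶜ, B (Function.update m k z ⟨2 * i.1, by omega⟩)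
      (Function.update m k z ⟨2 * i.1 + 1, by omega⟩) =
      ∏ i ∈ ({i₀}ᶜ : Finset (Fin n)), B (m ⟨2 * i.1, by omega⟩)
        (m ⟨2 * i.1 + 1, by omega⟩) := by
    intro z
    refine Finset.prod_congr rfl fun i hi => ?_
    have hne : i.1 ≠ k.1 / 2 := by
      intro h
      simp only [Finset.mem_compl, Finset.mem_singleton] at hi
      exact hi (Fin.ext h)
    rw [Function.update_of_ne, Function.update_of_ne]
    · intro h; have := congrArg Fin.val h; simp at this; omega
    · intro h; have := congrArg Fin.val h; simp at this; omega
  set C := ∏ i ∈ ({i₀}ᶜ : Finset (Fin n)), B (m ⟨2 * i.1, by omega⟩)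
        (m ⟨2 * i.1 + 1, by omega⟩) with hC
  rcases Nat.even_or_odd k.1 with hk | hk
  · refine ⟨C • B.flip (m ⟨2 * i₀.1 + 1, by omega⟩), fun z => ?_⟩
    rw [Fintype.prod_eq_mul_prod_compl i₀, hrest]
    have h1 : (⟨2 * i₀.1, by omega⟩ : Fin (2 * n)) = k := by
      ext; obtain ⟨r, hr⟩ := hk; simp [hi₀]; omega
    rw [h1, Function.update_self, Function.update_of_ne]
    · simp [mul_comm]
    · intro h; have := congrArg Fin.val (h.trans h1.symm); simp at this
  · refine ⟨C • B (m ⟨2 * i₀.1, by omega⟩), fun z => ?_⟩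
    rw [Fintype.prod_eq_mul_prod_compl i₀, hrest]
    have h1 : (⟨2 * i₀.1 + 1, by omega⟩ : Fin (2 * n)) = k := by
      ext; obtain ⟨r, hr⟩ := hk; simp [hi₀]; omega
    rw [h1, Function.update_self, Function.update_of_ne]
    · simp [mul_comm]
    · intro h; have := congrArg Fin.val (h.trans h1.symm); simp at this

/-- The product `∏ i, B (m (2i)) (m (2i+1))` as a multilinear map. -/
def pairingMultilinear (n : ℕ) (B : V →ₗ[ℝ] V →ₗ[ℝ] ℝ) :
    MultilinearMap ℝ (fun _ : Fin (2 * n) => V) ℝ :=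
  MultilinearMap.mk' (fun m => ∏ i : Fin n, B (m ⟨2 * i.1, by omega⟩) (m ⟨2 * i.1 + 1, by omega⟩))
    (by
      intro m k x y
      obtain ⟨g, hg⟩ := exists_linear_prod_pairing_update B m k
      simp only [hg, map_add])
    (by
      intro m k c x
      obtain ⟨g, hg⟩ := exists_linear_prod_pairing_update B m k
      simp only [hg, map_smul])

/-- The Pfaffian of the matrix of a bilinear form in a family of vectors. -/
def bilinPfaffian (B : V →ₗ[ℝ] V →ₗ[ℝ] ℝ) (m : Fin (2 * n) → V) : ℝ :=
  pfaffian (Matrix.of fun i j => B (m i) (m j))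

theorem bilinPfaffian_eq_alternatization (B : V →ₗ[ℝ] V →ₗ[ℝ] ℝ) (m : Fin (2 * n) → V) :
    bilinPfaffian B m = (((2 : ℝ) ^ n * (n.factorial : ℝ))⁻¹ •
      MultilinearMap.alternatization (pairingMultilinear n B)) m := by
  rw [AlternatingMap.smul_apply, MultilinearMap.alternatization_apply]
  unfold bilinPfaffian pfaffian
  rw [smul_eq_mul]
  congr 1
  refine Finset.sum_congr rfl fun σ _ => ?_
  rw [Units.smul_def, zsmul_eq_mul]
  rfl

/-- Alternating maps of top degree form a line spanned by the determinant. This makes all quotients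
of Pfaffians independent of the basis. -/
theorem bilinPfaffian_eq_det_mul (B : V →ₗ[ℝ] V →ₗ[ℝ] ℝ) (b : Module.Basis (Fin (2 * n)) ℝ V)
    (m : Fin (2 * n) → V) : bilinPfaffian B m = b.det m * bilinPfaffian B b := by
  rw [bilinPfaffian_eq_alternatization, bilinPfaffian_eq_alternatization,
    AlternatingMap.eq_smul_basis_det b (((2 : ℝ) ^ n * (n.factorial : ℝ))⁻¹ •
      MultilinearMap.alternatization (pairingMultilinear n B))]
  simp [mul_comm, Module.Basis.det_self]

/-- Every permutation puts k into some pair, so each term of the sum contains a zero factor. -/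
theorem bilinPfaffian_eq_zero_of_forall (B : V →ₗ[ℝ] V →ₗ[ℝ] ℝ) (m : Fin (2 * n) → V)
    (k : Fin (2 * n)) (hl : ∀ u, B (m k) u = 0) (hr : ∀ u, B u (m k) = 0) :
    bilinPfaffian B m = 0 := by
  unfold bilinPfaffian pfaffian
  refine mul_eq_zero_of_right _ (Finset.sum_eq_zero fun σ _ => mul_eq_zero_of_right _ ?_)
  refine Finset.prod_eq_zero (Finset.mem_univ (⟨(σ.symm k).1 / 2, by omega⟩ : Fin n)) ?_
  rcases Nat.even_or_odd (σ.symm k).1 with hk | hk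
  · have h1 : (⟨2 * ((σ.symm k).1 / 2), by omega⟩ : Fin (2 * n)) = σ.symm k := by
      ext; obtain ⟨r, hr⟩ := hk; simp; omega
    simp [h1, hl]
  · have h1 : (⟨2 * ((σ.symm k).1 / 2) + 1, by omega⟩ : Fin (2 * n)) = σ.symm k := by
      ext; obtain ⟨r, hr⟩ := hk; simp; omega
    simp [h1, hr]

/-- A nonzero vector of a space of dimension `d` belongs to a basis indexed by `Fin d`. -/
theorem exists_basis_mem {d : ℕ} (b : Module.Basis (Fin d) ℝ V) {v : V} (hv : v ≠ 0) :
    ∃ (c : Module.Basis (Fin d) ℝ V) (k : Fin d), c k = v := by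
  have hs : LinearIndepOn ℝ id ({v} : Set V) := LinearIndepOn.singleton (by simpa using hv)
  let c := Module.Basis.extend hs
  let e := c.indexEquiv b
  have hmem : v ∈ hs.extend (subset_univ _) := hs.subset_extend _ (mem_singleton v)
  exact ⟨c.reindex e, e ⟨v, hmem⟩, by simp [c]⟩

theorem bilinPfaffian_eq_zero_of_degenerate (B : V →ₗ[ℝ] V →ₗ[ℝ] ℝ)
    (b : Module.Basis (Fin (2 * n)) ℝ V) {v : V} (hv : v ≠ 0) (hl : ∀ u, B v u = 0)
    (hr : ∀ u, B u v = 0) : bilinPfaffian B b = 0 := by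
  obtain ⟨c, k, rfl⟩ := exists_basis_mem b hv
  rw [bilinPfaffian_eq_det_mul B c, bilinPfaffian_eq_zero_of_forall B c k hl hr, mul_zero]

/-- A family splitting `ker α` off: one member is a given vector of `ker α`, one is outside
`ker α`, all others are in `ker α`. -/
theorem exists_basis_adapted {d : ℕ} (b : Module.Basis (Fin d) ℝ V) (α : V →ₗ[ℝ] ℝ) (hα : α ≠ 0)
    {v : V} (hv : v ≠ 0) (hαv : α v = 0) :
    ∃ (c : Module.Basis (Fin d) ℝ V) (i₀ i₁ : Fin d), i₀ ≠ i₁ ∧ c i₀ = v ∧ α (c i₁) ≠ 0 ∧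
      ∀ j, j ≠ i₁ → α (c j) = 0 := by
  have := Module.Basis.finiteDimensional_of_finite b
  obtain ⟨w, hw⟩ : ∃ w, α w ≠ 0 := by
    by_contra! h
    exact hα (LinearMap.ext h)
  let v' : LinearMap.ker α := ⟨v, hαv⟩
  have hv' : v' ≠ 0 := fun h => hv (congrArg Subtype.val h)
  obtain ⟨c, k, hk⟩ := exists_basis_mem (Module.finBasis ℝ (LinearMap.ker α)) hv'
  -- A basis of `ker α` through v, completed by a vector w outside the kernel, is a basis of V;
  -- `none` indexes w.
  have hli : LinearIndependent ℝ
      (fun o => Option.casesOn' o w (fun i => (c i : V)) : Option _ → V) := by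
    rw [linearIndependent_option']
    refine ⟨c.linearIndependent.map' _ (Submodule.ker_subtype _), fun hmem => hw ?_⟩
    have : Submodule.span ℝ (range fun i => (c i : V)) ≤ LinearMap.ker α := by
      rw [Submodule.span_le]
      rintro _ ⟨i, rfl⟩
      exact (c i).2
    exact this hmem
  have hcard : Fintype.card (Option (Fin (Module.finrank ℝ (LinearMap.ker α)))) =
      Module.finrank ℝ V := by
    rw [Fintype.card_option, Fintype.card_fin]
    have h1 := LinearMap.finrank_range_add_finrank_ker α
    have h2 : LinearMap.range α = ⊤ := LinearMap.range_eq_top.2 (LinearMap.surjective hα)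
    rw [h2, finrank_top, Module.finrank_self] at h1
    omega
  let c' := basisOfLinearIndependentOfCardEqFinrank hli hcard
  let e := c'.indexEquiv b
  refine ⟨c'.reindex e, e (some k), e none, by simp, ?_, ?_, ?_⟩
  · simp [c', hk, v']
  · simpa [c'] using hw
  · intro j hj
    obtain ⟨o, rfl⟩ := e.surjective j
    cases o with
    | none => exact absurd rfl hj
    | some i => simp [c']

/-- If two skew matrices have a row supported at one and the same off-diagonal entry and agree away
from that row and the corresponding column index, then their Pfaffians are proportional to these
entries. -/
theorem pfaffian_mul_eq_of_row (A B : Matrix (Fin (2 * n)) (Fin (2 * n)) ℝ)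
    (hA : ∀ i j, A i j = -A j i) (hB : ∀ i j, B i j = -B j i) {i₀ i₁ : Fin (2 * n)}
    (hA₀ : ∀ j, j ≠ i₁ → A i₀ j = 0) (hB₀ : ∀ j, j ≠ i₁ → B i₀ j = 0)
    (hAB : ∀ i j, i ≠ i₀ → i ≠ i₁ → j ≠ i₀ → j ≠ i₁ → A i j = B i j) :
    pfaffian A * B i₀ i₁ = pfaffian B * A i₀ i₁ := by
  unfold pfaffian
  rw [mul_assoc, mul_assoc, Finset.sum_mul, Finset.sum_mul]
  congr 1
  refine Finset.sum_congr rfl fun σ _ => ?_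
  rw [mul_assoc, mul_assoc]
  congr 1
  -- The identity holds term by term in σ. The pair containing i₀ is isolated: if its partner is i₁,
  -- the other pairs avoid both indices and the remaining products agree; otherwise both terms
  -- vanish.
  set i : Fin n := ⟨(σ.symm i₀).1 / 2, by omega⟩ with hi
  rw [Fintype.prod_eq_mul_prod_compl i, Fintype.prod_eq_mul_prod_compl i (fun j : Fin n => B _ _)]
  set p : Fin (2 * n) := ⟨2 * i.1, by omega⟩ with hp
  set q : Fin (2 * n) := ⟨2 * i.1 + 1, by omega⟩ with hq
  have hpq : p ≠ q := by intro h; have := congrArg Fin.val h; simp [p, q] at this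
  have hcase : σ p = i₀ ∨ σ q = i₀ := by
    rcases Nat.even_or_odd (σ.symm i₀).1 with hk | hk
    · left
      have h1 : p = σ.symm i₀ := by
        ext; obtain ⟨r, hr⟩ := hk; simp [p, i]; omega
      simp [h1]
    · right
      have h1 : q = σ.symm i₀ := by
        ext; obtain ⟨r, hr⟩ := hk; simp [q, i]; omega
      simp [h1]
  have hrest : σ p = i₁ ∨ σ q = i₁ → ∏ j ∈ ({i}ᶜ : Finset (Fin n)),
      A (σ ⟨2 * j.1, by omega⟩) (σ ⟨2 * j.1 + 1, by omega⟩) = ∏ j ∈ ({i}ᶜ : Finset (Fin n)),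
      B (σ ⟨2 * j.1, by omega⟩) (σ ⟨2 * j.1 + 1, by omega⟩) := by
    intro hi₁
    refine Finset.prod_congr rfl fun j hj => ?_
    have hne : j.1 ≠ i.1 := by
      intro h
      simp only [Finset.mem_compl, Finset.mem_singleton] at hj
      exact hj (Fin.ext h)
    have hdist : ∀ r : Fin (2 * n), r ≠ p → r ≠ q → (σ p = i₁ ∨ σ q = i₁) →
        (σ p = i₀ ∨ σ q = i₀) → σ r ≠ i₀ ∧ σ r ≠ i₁ := by
      intro r hrp hrq h1 h0
      have h2 : σ r ≠ σ p := fun h => hrp (σ.injective h)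
      have h3 : σ r ≠ σ q := fun h => hrq (σ.injective h)
      constructor
      · rcases h0 with h0 | h0 <;> rw [← h0] <;> assumption
      · rcases h1 with h1 | h1 <;> rw [← h1] <;> assumption
    have e1 := hdist ⟨2 * j.1, by omega⟩
      (by intro h; have := congrArg Fin.val h; simp [p] at this; omega)
      (by intro h; have := congrArg Fin.val h; simp [q] at this; omega) hi₁ hcase
    have e2 := hdist ⟨2 * j.1 + 1, by omega⟩
      (by intro h; have := congrArg Fin.val h; simp [p] at this; omega)
      (by intro h; have := congrArg Fin.val h; simp [q] at this; omega) hi₁ hcase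
    exact hAB _ _ e1.1 e1.2 e2.1 e2.2
  rcases hcase with h0 | h0
  · by_cases h1 : σ q = i₁
    · rw [hrest (Or.inr h1), h0, h1]; ring
    · rw [h0, hA₀ _ h1, hB₀ _ h1]; simp
  · by_cases h1 : σ p = i₁
    · rw [hrest (Or.inl h1), h0, h1, hA i₁ i₀, hB i₁ i₀]; ring
    · rw [h0, hA _ i₀, hB _ i₀, hA₀ _ h1, hB₀ _ h1]; simp

end PfaffianForm

/-! ### Nonvanishing of the Pfaffian of a nondegenerate form -/

section Nondegenerate

/-- A nondegenerate alternating bilinear form on a space of dimension `2n` has a symplectic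
family. -/
theorem exists_symplectic_family (n : ℕ) : ∀ {V : Type*} [AddCommGroup V] [Module ℝ V]
    [FiniteDimensional ℝ V] (B : V →ₗ[ℝ] V →ₗ[ℝ] ℝ), (∀ u, B u u = 0) →
    (∀ u, (∀ w, B u w = 0) → u = 0) → Module.finrank ℝ V = 2 * n →
    ∃ p q : Fin n → V, (∀ i j, B (p i) (p j) = 0) ∧ (∀ i j, B (q i) (q j) = 0) ∧
      ∀ i j, B (p i) (q j) = if i = j then 1 else 0 := by
  induction n with
  | zero =>
    intro V _ _ _ B _ _ _
    exact ⟨Fin.elim0, Fin.elim0, fun i => i.elim0, fun i => i.elim0, fun i => i.elim0⟩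
  | succ n ih =>
    intro V _ _ _ B halt hnd hdim
    have hskew : ∀ x y, B x y = -B y x := by
      intro x y
      have := halt (x + y)
      simp only [map_add, LinearMap.add_apply, halt] at this
      linarith
    obtain ⟨v, hv⟩ : ∃ v : V, v ≠ 0 := by
      have : Nontrivial V := Module.nontrivial_of_finrank_pos (R := ℝ) (by omega)
      exact exists_ne 0
    obtain ⟨w₀, hw₀⟩ : ∃ w, B v w ≠ 0 := by
      by_contra! h
      exact hv (hnd v h)
    set w := (B v w₀)⁻¹ • w₀ with hw
    have hvw : B v w = 1 := by simp [hw, hw₀]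
    have hwv : B w v = -1 := by rw [hskew, hvw]
    -- The kernel of L is the symplectic complement of the hyperbolic plane spanned by v and w;
    -- induction runs on it.
    set L : V →ₗ[ℝ] ℝ × ℝ := (B v).prod (B w) with hL
    have hLsurj : Function.Surjective L := by
      rintro ⟨x, y⟩
      refine ⟨x • w - y • v, ?_⟩
      simp [hL, hvw, hwv, halt]
    have hker : ∀ x, x ∈ LinearMap.ker L ↔ B v x = 0 ∧ B w x = 0 := by
      intro x; simp [hL, LinearMap.mem_ker]
    have hfin : Module.finrank ℝ (LinearMap.ker L) = 2 * n := by
      have h1 := LinearMap.finrank_range_add_finrank_ker L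
      rw [LinearMap.range_eq_top.2 hLsurj, finrank_top, Module.finrank_prod,
        Module.finrank_self] at h1
      omega
    obtain ⟨p, q, hp, hq, hpq⟩ := ih
      ((B.compl₁₂ (LinearMap.ker L).subtype (LinearMap.ker L).subtype)) (fun u => halt u)
      (by
        intro u hu
        apply Subtype.ext
        apply hnd
        intro y
        -- This is the projection of y to the complement along the plane. As u is orthogonal to the
        -- plane, pairing with u does not see the correction.
        have hmem : y - B v y • w + B w y • v ∈ LinearMap.ker L := by
          rw [hker]
          simp [hvw, hwv, halt]
        have h1 := hu ⟨_, hmem⟩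
        have h2 := (hker u).1 u.2
        simp only [LinearMap.compl₁₂_apply, Submodule.subtype_apply, map_add, map_sub,
          map_smul, smul_eq_mul] at h1
        rw [hskew u w, hskew u v, h2.1, h2.2] at h1
        simpa using h1) hfin
    refine ⟨Fin.cons v fun i => (p i : V), Fin.cons w fun i => (q i : V), ?_, ?_, ?_⟩
    · intro i j
      refine Fin.cases ?_ (fun i => ?_) i <;> refine Fin.cases ?_ (fun j => ?_) j
      · simp [halt]
      · simpa using ((hker _).1 (p j).2).1
      · simpa using (hskew _ _).trans (neg_eq_zero.2 ((hker _).1 (p i).2).1)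
      · simpa using hp i j
    · intro i j
      refine Fin.cases ?_ (fun i => ?_) i <;> refine Fin.cases ?_ (fun j => ?_) j
      · simp [halt]
      · simpa using ((hker _).1 (q j).2).2
      · simpa using (hskew _ _).trans (neg_eq_zero.2 ((hker _).1 (q i).2).2)
      · simpa using hq i j
    · intro i j
      refine Fin.cases ?_ (fun i => ?_) i <;> refine Fin.cases ?_ (fun j => ?_) j
      · simp [hvw]
      · simpa [Fin.succ_ne_zero, (Fin.succ_ne_zero _).symm] using ((hker _).1 (q j).2).1
      · simpa [Fin.succ_ne_zero] using (hskew _ _).trans (neg_eq_zero.2 ((hker _).1 (p i).2).2)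
      · simpa using hpq i j

/-- The entries of the standard symplectic matrix, indexed by pairs. -/
def symplecticEntry {n : ℕ} (x y : Fin n × Fin 2) : ℝ :=
  if x.1 = y.1 then (if x.2 = y.2 then 0 else if x.2 = 0 then 1 else -1) else 0

/-- A nonzero term comes from a permutation that sends pairs to pairs, hence permutes the pairs by
some π and flips some of them. Permuting pairs is even, since π acts on two copies, and each flip
changes the sign of the permutation and of the product together. -/
theorem sign_mul_prod_symplecticEntry_nonneg {n : ℕ} (τ : Equiv.Perm (Fin n × Fin 2)) :
    0 ≤ ((Equiv.Perm.sign τ : ℤ) : ℝ) * ∏ i, symplecticEntry (τ (i, 0)) (τ (i, 1)) := by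
  classical
  by_cases hzero : ∃ i, symplecticEntry (τ (i, 0)) (τ (i, 1)) = 0
  · obtain ⟨i, hi⟩ := hzero
    rw [Finset.prod_eq_zero (Finset.mem_univ i) hi, mul_zero]
  push Not at hzero
  have hfst : ∀ i, (τ (i, 0)).1 = (τ (i, 1)).1 := by
    intro i
    by_contra h
    exact hzero i (by simp [symplecticEntry, h])
  have hsnd : ∀ i, (τ (i, 0)).2 ≠ (τ (i, 1)).2 := by
    intro i h
    exact hzero i (by simp [symplecticEntry, h])
  have hinj : Function.Injective fun i => (τ (i, 0)).1 := by
    intro i j hij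
    by_contra hne
    simp only at hij
    have h0 : (τ (j, 0)).2 = (τ (i, 0)).2 ∨ (τ (j, 0)).2 = (τ (i, 1)).2 := by
      have := hsnd i
      omega
    rcases h0 with h0 | h0
    · have := τ.injective (Prod.ext hij.symm h0)
      exact hne (congrArg Prod.fst this).symm
    · have := τ.injective (Prod.ext (hij.symm.trans (hfst i)) h0)
      exact hne (congrArg Prod.fst this).symm
  -- π is the induced permutation of the pairs, ρ i the flip inside the i-th pair.
  let π : Equiv.Perm (Fin n) := Equiv.ofBijective _ (Finite.injective_iff_bijective.1 hinj)
  let ρ : Fin n → Equiv.Perm (Fin 2) := fun i => if (τ (i, 0)).2 = 0 then 1 else Equiv.swap 0 1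
  have hτ : τ = (Equiv.prodCongrLeft fun _ : Fin 2 => π) * Equiv.prodCongrRight ρ := by
    ext1 ⟨i, a⟩
    have h1 : ((Equiv.prodCongrLeft fun _ : Fin 2 => π) * Equiv.prodCongrRight ρ) (i, a) =
      (π i, ρ i a) := rfl
    rw [h1]
    have h2 := hsnd i
    have h3 := hfst i
    apply Prod.ext
    · fin_cases a
      · rfl
      · exact h3.symm
    · simp only [ρ]
      split_ifs with h
      · fin_cases a
        · exact h
        · simp; omega
      · fin_cases a
        · simp; omega
        · simp; omega
  have hentry : ∀ i, symplecticEntry (τ (i, 0)) (τ (i, 1)) =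
      ((Equiv.Perm.sign (ρ i) : ℤ) : ℝ) := by
    intro i
    simp only [symplecticEntry, hfst i, hsnd i, if_true, if_false, ρ]
    split_ifs with h
    · simp
    · rw [Equiv.Perm.sign_swap (by decide)]; simp
  have hsign : Equiv.Perm.sign τ = ∏ i, Equiv.Perm.sign (ρ i) := by
    conv_lhs => rw [hτ]
    rw [Equiv.Perm.sign_mul, Equiv.Perm.sign_prodCongrLeft, Equiv.Perm.sign_prodCongrRight]
    simp
  rw [Finset.prod_congr rfl fun i _ => hentry i, hsign]
  push_cast
  exact mul_self_nonneg _

theorem bilinPfaffian_ne_zero_of_symplectic {n : ℕ} {V : Type*} [AddCommGroup V] [Module ℝ V]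
    (B : V →ₗ[ℝ] V →ₗ[ℝ] ℝ) (f : Fin n × Fin 2 → V)
    (hf : ∀ x y, B (f x) (f y) = symplecticEntry x y) (e : Fin (2 * n) ≃ Fin n × Fin 2)
    (he₀ : ∀ i : Fin n, e ⟨2 * i.1, by omega⟩ = (i, 0))
    (he₁ : ∀ i : Fin n, e ⟨2 * i.1 + 1, by omega⟩ = (i, 1)) :
    bilinPfaffian B (f ∘ e) ≠ 0 := by
  unfold bilinPfaffian pfaffian
  refine mul_ne_zero (by positivity) (ne_of_gt ?_)
  have h1 : ∀ σ : Equiv.Perm (Fin (2 * n)), ((Equiv.Perm.sign σ : ℤ) : ℝ) *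
      ∏ i : Fin n, (Matrix.of fun i j => B ((f ∘ e) i) ((f ∘ e) j))
        (σ ⟨2 * i.1, by omega⟩) (σ ⟨2 * i.1 + 1, by omega⟩) =
      ((Equiv.Perm.sign (e.permCongr σ) : ℤ) : ℝ) *
        ∏ i, symplecticEntry (e.permCongr σ (i, 0)) (e.permCongr σ (i, 1)) := by
    intro σ
    rw [Equiv.Perm.sign_permCongr]
    congr 1
    refine Finset.prod_congr rfl fun i _ => ?_
    rw [Matrix.of_apply, Function.comp_apply, Function.comp_apply, hf, ← he₀, ← he₁]
    simp [Equiv.permCongr_apply]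
  rw [Finset.sum_congr rfl fun σ _ => h1 σ]
  refine Finset.sum_pos' (fun σ _ => sign_mul_prod_symplecticEntry_nonneg _)
    ⟨1, Finset.mem_univ _, ?_⟩
  have h2 : e.permCongr 1 = 1 := by ext1 x; simp [Equiv.permCongr_apply]
  rw [h2]
  simp [symplecticEntry]

/-- In a symplectic family no term of the sum is negative and the identity contributes 1.
Nonvanishing passes to any basis through the determinant factor. -/
theorem bilinPfaffian_ne_zero_of_nondegenerate {n : ℕ} {V : Type*} [AddCommGroup V] [Module ℝ V]
    (B : V →ₗ[ℝ] V →ₗ[ℝ] ℝ) (b : Module.Basis (Fin (2 * n)) ℝ V) (halt : ∀ u, B u u = 0)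
    (hnd : ∀ u, (∀ w, B u w = 0) → u = 0) : bilinPfaffian B b ≠ 0 := by
  have := Module.Basis.finiteDimensional_of_finite b
  have hskew : ∀ x y, B x y = -B y x := by
    intro x y
    have := halt (x + y)
    simp only [map_add, LinearMap.add_apply, halt] at this
    linarith
  obtain ⟨p, q, hp, hq, hpq⟩ := exists_symplectic_family n B halt hnd
    (by rw [Module.finrank_eq_card_basis b, Fintype.card_fin])
  let f : Fin n × Fin 2 → V := fun x => if x.2 = 0 then p x.1 else q x.1
  let e : Fin (2 * n) ≃ Fin n × Fin 2 := (finCongr (mul_comm 2 n)).trans finProdFinEquiv.symm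
  have hf : ∀ x y, B (f x) (f y) = symplecticEntry x y := by
    rintro ⟨i, a⟩ ⟨j, c⟩
    fin_cases a <;> fin_cases c
    · simp [f, symplecticEntry, hp]
    · simp [f, symplecticEntry, hpq]
    · simp only [f, symplecticEntry]
      simp only [Fin.mk_one, Fin.isValue, one_ne_zero, if_false, Fin.zero_eta, if_true]
      rw [hskew, hpq]
      by_cases h : i = j
      · simp [h]
      · simp [h, Ne.symm h]
    · simp [f, symplecticEntry, hq]
  have hne := bilinPfaffian_ne_zero_of_symplectic B f hf e
    (by
      intro i
      simp only [e, Equiv.trans_apply, Equiv.symm_apply_eq]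
      ext; simp [finProdFinEquiv])
    (by
      intro i
      simp only [e, Equiv.trans_apply, Equiv.symm_apply_eq]
      ext; simp [finProdFinEquiv]; omega)
  rw [bilinPfaffian_eq_det_mul B b] at hne
  exact right_ne_zero_of_mul hne

end Nondegenerate

/-! ### The Pfaffian of a pencil as a polynomial -/

section PfaffianPencil

open Polynomial

variable {n : ℕ}

/-- The Pfaffian of `A - t B` as a polynomial in `t`. -/
def pfaffianPencil (A B : Matrix (Fin (2 * n)) (Fin (2 * n)) ℝ) : ℝ[X] :=
  C ((2 : ℝ) ^ n * (n.factorial : ℝ))⁻¹ *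
    ∑ σ : Equiv.Perm (Fin (2 * n)), C ((Equiv.Perm.sign σ : ℤ) : ℝ) *
      ∏ i : Fin n, (C (A (σ ⟨2 * i.1, by omega⟩) (σ ⟨2 * i.1 + 1, by omega⟩)) -
        C (B (σ ⟨2 * i.1, by omega⟩) (σ ⟨2 * i.1 + 1, by omega⟩)) * X)

theorem eval_pfaffianPencil (A B : Matrix (Fin (2 * n)) (Fin (2 * n)) ℝ) (t : ℝ) :
    (pfaffianPencil A B).eval t = pfaffian (A - t • B) := by
  simp [pfaffianPencil, pfaffian, eval_finsetSum, eval_prod, mul_comm t]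

theorem natDegree_C_sub_C_mul_X_le (a b : ℝ) : (C a - C b * X).natDegree ≤ 1 := by
  compute_degree

theorem natDegree_pfaffianPencil_le (A B : Matrix (Fin (2 * n)) (Fin (2 * n)) ℝ) :
    (pfaffianPencil A B).natDegree ≤ n := by
  unfold pfaffianPencil
  refine (natDegree_C_mul_le _ _).trans (natDegree_sum_le_of_forall_le _ _ fun σ _ => ?_)
  refine (natDegree_C_mul_le _ _).trans ((natDegree_prod_le _ _).trans ?_)
  refine (Finset.sum_le_sum fun i _ => natDegree_C_sub_C_mul_X_le _ _).trans ?_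
  simp

theorem coeff_pfaffianPencil (A B : Matrix (Fin (2 * n)) (Fin (2 * n)) ℝ) :
    (pfaffianPencil A B).coeff n = (-1) ^ n * pfaffian B := by
  unfold pfaffianPencil pfaffian
  rw [coeff_C_mul, finsetSum_coeff, mul_left_comm]
  congr 1
  rw [Finset.mul_sum]
  refine Finset.sum_congr rfl fun σ _ => ?_
  rw [coeff_C_mul, mul_left_comm]
  congr 1
  have h := coeff_prod_of_natDegree_le (s := Finset.univ) (fun i : Fin n =>
    (C (A (σ ⟨2 * i.1, by omega⟩) (σ ⟨2 * i.1 + 1, by omega⟩)) -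
        C (B (σ ⟨2 * i.1, by omega⟩) (σ ⟨2 * i.1 + 1, by omega⟩)) * X)) 1
    (fun i _ => natDegree_C_sub_C_mul_X_le _ _)
  rw [Finset.card_univ, Fintype.card_fin, mul_one] at h
  rw [h]
  simp [Finset.prod_neg, coeff_C]

/-- The coefficients of the Pfaffian of a smooth pencil are smooth. -/
theorem contDiffOn_coeff_pfaffianPencil {E : Type*} [NormedAddCommGroup E] [NormedSpace ℝ E]
    {s : Set E} {m : WithTop ℕ∞} {A B : E → Matrix (Fin (2 * n)) (Fin (2 * n)) ℝ}
    (hA : ∀ i j, ContDiffOn ℝ m (fun y => A y i j) s)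
    (hB : ∀ i j, ContDiffOn ℝ m (fun y => B y i j) s) (k : ℕ) :
    ContDiffOn ℝ m (fun y => (pfaffianPencil (A y) (B y)).coeff k) s := by
  simp only [pfaffianPencil, coeff_C_mul, finsetSum_coeff]
  refine contDiffOn_const.mul (ContDiffOn.sum fun σ _ => contDiffOn_const.mul ?_)
  -- The induction is on the set of factors, for all coefficients at once, because a coefficient of
  -- a product involves all lower ones.
  have key : ∀ (S : Finset (Fin n)) (k : ℕ), ContDiffOn ℝ m (fun y => (∏ i ∈ S,
      (C (A y (σ ⟨2 * i.1, by omega⟩) (σ ⟨2 * i.1 + 1, by omega⟩)) -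
        C (B y (σ ⟨2 * i.1, by omega⟩) (σ ⟨2 * i.1 + 1, by omega⟩)) * X)).coeff k) s := by
    intro S
    induction S using Finset.induction_on with
    | empty => intro k; simp only [Finset.prod_empty]; exact contDiffOn_const
    | insert i S hi ih =>
      intro k
      simp only [Finset.prod_insert hi, coeff_mul]
      refine ContDiffOn.sum fun x _ => ContDiffOn.mul ?_ (ih _)
      simp only [coeff_sub, coeff_C_mul]
      refine ContDiffOn.sub ?_ ((hB _ _).mul contDiffOn_const)
      simp only [coeff_C]
      split_ifs
      · exact hA _ _
      · exact contDiffOn_const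
  exact key _ k

end PfaffianPencil

/-! ### Closed forms and regular level sets in a normed space -/

section LocalCalculus

variable {E : Type*} [NormedAddCommGroup E] [NormedSpace ℝ E]

variable (E) in
/-- Two-forms as bilinear maps. -/
def twoFormCLM : (E [⋀^Fin 2]→L[ℝ] ℝ) →L[ℝ] E →L[ℝ] E →L[ℝ] ℝ :=
  (ContinuousLinearMap.compL ℝ E (E [⋀^Fin 1]→L[ℝ] ℝ) (E →L[ℝ] ℝ)
    (ContinuousAlternatingMap.ofSubsingletonLIE (𝕜 := ℝ) (E := E) (F := ℝ)
      (0 : Fin 1)).symm.toContinuousLinearEquiv.toContinuousLinearMap) ∘L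
    (ContinuousAlternatingMap.curryLeftLI (𝕜 := ℝ) (E := E) (F := ℝ) (n := 1)).toContinuousLinearMap

@[simp]
theorem twoFormCLM_apply (η : E [⋀^Fin 2]→L[ℝ] ℝ) (u w : E) : twoFormCLM E η u w = η ![u, w] := by
  change η (Matrix.vecCons u fun _ => w) = _
  congr 1
  ext i
  fin_cases i <;> rfl

theorem twoForm_swap {V : Type*} [AddCommGroup V] [Module ℝ V] [TopologicalSpace V]
    (η : V [⋀^Fin 2]→L[ℝ] ℝ) (u w : V) : η ![u, w] = -η ![w, u] := by
  have h := η.toAlternatingMap.map_swap ![w, u] (i := 0) (j := 1) (by decide)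
  have h2 : (![w, u] ∘ (Equiv.swap (0 : Fin 2) 1) : Fin 2 → V) = ![u, w] := by
    ext i
    fin_cases i <;> simp
  rw [h2] at h
  exact h

/-- The cyclic identity for the derivative of a closed two-form. -/
theorem fderiv_twoFormCLM_cyclic {η : E → E [⋀^Fin 2]→L[ℝ] ℝ} {y : E}
    (hη : DifferentiableAt ℝ η y) (hcl : extDeriv η y = 0) (u v w : E) :
    fderiv ℝ (fun z => twoFormCLM E (η z)) y u v w - fderiv ℝ (fun z => twoFormCLM E (η z)) y v u w
      + fderiv ℝ (fun z => twoFormCLM E (η z)) y w u v = 0 := by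
  have h1 : fderiv ℝ (fun z => twoFormCLM E (η z)) y = (twoFormCLM E) ∘L fderiv ℝ η y := by
    have hL : HasFDerivAt (twoFormCLM E) (twoFormCLM E) (η y) :=
      ContinuousLinearMap.hasFDerivAt (𝕜 := ℝ) (E := E [⋀^Fin 2]→L[ℝ] ℝ)
        (F := E →L[ℝ] E →L[ℝ] ℝ) (twoFormCLM E)
    exact (HasFDerivAt.comp (𝕜 := ℝ) (E := E) (F := E [⋀^Fin 2]→L[ℝ] ℝ)
      (G := E →L[ℝ] E →L[ℝ] ℝ) y hL hη.hasFDerivAt).fderiv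
  have h2 : extDeriv η y ![u, v, w] = 0 := by rw [hcl]; rfl
  rw [extDeriv_apply hη] at h2
  erw [Fin.sum_univ_three] at h2
  simp only [fderiv_continuousAlternatingMap_apply_const_apply hη] at h2
  have e0 : Fin.removeNth 0 ![u, v, w] = ![v, w] := by ext i; fin_cases i <;> rfl
  have e1 : Fin.removeNth 1 ![u, v, w] = ![u, w] := by ext i; fin_cases i <;> rfl
  have e2 : Fin.removeNth 2 ![u, v, w] = ![u, v] := by ext i; fin_cases i <;> rfl
  simp only [e0, e1, e2] at h2
  simp only [h1, ContinuousLinearMap.comp_apply, twoFormCLM_apply]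
  simpa [sub_eq_add_neg] using h2

/-- A function vanishing on a regular level set has differential vanishing on its tangent space. -/
theorem apply_eq_zero_of_eventually_level [CompleteSpace E] {H φ : E → ℝ} {H' φ' : E →L[ℝ] ℝ}
    {y : E} (hH : HasStrictFDerivAt H H' y) (hH' : H' ≠ 0) (hφ : HasStrictFDerivAt φ φ' y)
    (hz : ∀ᶠ z in 𝓝 y, H z = H y → φ z = 0) : ∃ a : ℝ, φ' = a • H' := by
  have hy : φ y = 0 := hz.self_of_nhds rfl
  -- Being zero on the level set, φ has a constrained extremum at y, so Lagrange multipliers apply;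
  -- H' ≠ 0 keeps the multiplier of φ' from vanishing.
  have hext : IsLocalExtrOn φ {z | H z = H y} y := by
    refine Or.inl ?_
    rw [IsMinFilter, eventually_nhdsWithin_iff]
    filter_upwards [hz] with z h1 h2
    rw [h1 h2, hy]
  obtain ⟨a, b, hab, h⟩ := hext.exists_multipliers_of_hasStrictFDerivAt_1d hH hφ
  have hb : b ≠ 0 := by
    rintro rfl
    rw [zero_smul, add_zero, smul_eq_zero] at h
    rcases h with h | h
    · exact hab (by simp [h])
    · exact hH' h
  refine ⟨-(a / b), ?_⟩
  have h2 : b • φ' = -(a • H') := by rw [eq_neg_iff_add_eq_zero, add_comm]; exact h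
  have h3 : φ' = b⁻¹ • (b • φ') := by rw [smul_smul, inv_mul_cancel₀ hb, one_smul]
  rw [h3, h2]
  ext x
  simp only [smul_apply, neg_apply, smul_eq_mul]
  field_simp

variable {B : E → E →L[ℝ] E →L[ℝ] ℝ} {V : E → E} {H c : E → ℝ} {y : E}

/-- The Lie derivative along `V` of a closed two-form with `ι_V B = c dH` on a regular level set
of `H` vanishes on the tangent space of the level set. -/
theorem lieDeriv_eq_zero_of_contraction [CompleteSpace E] (hB : ContDiffAt ℝ 1 B y)
    (hskew : ∀ᶠ z in 𝓝 y, ∀ u w, B z u w = -B z w u)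
    (hcl : ∀ u v w, fderiv ℝ B y u v w - fderiv ℝ B y v u w + fderiv ℝ B y w u v = 0)
    (hV : ContDiffAt ℝ 1 V y) (hH : ContDiffAt ℝ 2 H y) (hH' : fderiv ℝ H y ≠ 0)
    (hc : ContDiffAt ℝ 1 c y)
    (hQ : ∀ᶠ z in 𝓝 y, H z = H y → ∀ u, B z (V z) u = c z * fderiv ℝ H z u) {u w : E}
    (hu : fderiv ℝ H y u = 0) (hw : fderiv ℝ H y w = 0) :
    fderiv ℝ B y (V y) u w + B y (fderiv ℝ V y u) w + B y u (fderiv ℝ V y w) = 0 := by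
  have hdB := (hB.differentiableAt one_ne_zero).hasFDerivAt
  have hdV := (hV.differentiableAt one_ne_zero).hasFDerivAt
  have hdc := (hc.differentiableAt one_ne_zero).hasFDerivAt
  have hdH1 : ContDiffAt ℝ 1 (fderiv ℝ H) y := hH.fderiv_right (by norm_num)
  have hdH := (hdH1.differentiableAt one_ne_zero).hasFDerivAt
  have hHs : HasStrictFDerivAt H (fderiv ℝ H y) y := hH.hasStrictFDerivAt (by norm_num)
  -- The relation B(V, z) = c dH(z) holds only on the level set, so it is differentiated in a
  -- tangent direction x: the multiplier term a dH(x) and the term dc(x) dH(z) both vanish.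
  have key : ∀ x z : E, fderiv ℝ H y x = 0 → fderiv ℝ H y z = 0 →
      fderiv ℝ B y x (V y) z + B y (fderiv ℝ V y x) z = c y * fderiv ℝ (fderiv ℝ H) y x z := by
    intro x z hx hz
    have hφ : ContDiffAt ℝ 1 (fun p => B p (V p) z - c p * fderiv ℝ H p z) y :=
      ((hB.clm_apply hV).clm_apply contDiffAt_const).sub
        (hc.mul (hdH1.clm_apply contDiffAt_const))
    obtain ⟨a, ha⟩ := apply_eq_zero_of_eventually_level hHs hH'
      (hφ.hasStrictFDerivAt (by norm_num)) (hQ.mono fun p hp h => by rw [hp h, sub_self])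
    have hd := ((hdB.clm_apply hdV).clm_apply (hasFDerivAt_const z y)).fun_sub
      (hdc.fun_mul (hdH.clm_apply (hasFDerivAt_const z y)))
    have h2 := congrArg (fun l => l x) (hd.fderiv.symm.trans ha)
    simp [hx, hz] at h2
    linarith
  -- Antisymmetrizing `key` in u, w cancels the Hessian of H; the cyclic identity for (V, u, w) then
  -- gives the Lie derivative.
  have hsym : fderiv ℝ (fderiv ℝ H) y u w = fderiv ℝ (fderiv ℝ H) y w u :=
    (hH.isSymmSndFDerivAt (by simp)).eq u w
  have h1 := key u w hu hw
  have h2 := key w u hw hu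
  have h3 := hcl (V y) u w
  have hsk : ∀ x p q, fderiv ℝ B y x p q = -fderiv ℝ B y x q p := by
    intro x p q
    have e1 := ((hdB.clm_apply (hasFDerivAt_const p y)).clm_apply (hasFDerivAt_const q y))
    have e2 := ((hdB.clm_apply (hasFDerivAt_const q y)).clm_apply (hasFDerivAt_const p y)).fun_neg
    have e3 := e2.congr_of_eventuallyEq (hskew.mono fun z hz => hz p q)
    have := congrArg (fun l => l x) (e1.unique e3)
    simpa using this
  have h4 := hskew.self_of_nhds u (fderiv ℝ V y w)
  rw [hsym] at h1
  rw [hsk w (V y) u] at h2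
  rw [hsk w (V y) u] at h3
  linarith
end LocalCalculus

/-! ### The Pfaffian in a frame carried along an integral curve -/

section FrameAlongCurve

variable {n : ℕ}

theorem differentiable_pfaffian_of :
    Differentiable ℝ fun A : Fin (2 * n) → Fin (2 * n) → ℝ => pfaffian (Matrix.of A) := by
  unfold pfaffian
  simp only [Matrix.of_apply]
  fun_prop

/-- Derivative of the Pfaffian of a skew matrix along a curve whose velocity is supported in the
two rows and columns `i₀`, `i₁`, where row `i₀` is supported at `i₁`. -/
theorem hasDerivAt_pfaffian_of_row {M : ℝ → Fin (2 * n) → Fin (2 * n) → ℝ}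
    {M' : Fin (2 * n) → Fin (2 * n) → ℝ} {s : ℝ} (hM : HasDerivAt M M' s)
    (hsk : ∀ i j, M s i j = -M s j i) (hsk' : ∀ i j, M' i j = -M' j i) {i₀ i₁ : Fin (2 * n)}
    (h0 : ∀ j, j ≠ i₁ → M s i₀ j = 0) (h0' : ∀ i j, i ≠ i₁ → j ≠ i₁ → M' i j = 0)
    (hi : i₀ ≠ i₁) :
    ∃ X' : ℝ, HasDerivAt (fun r => pfaffian (Matrix.of (M r))) X' s ∧
      M s i₀ i₁ * X' = pfaffian (Matrix.of (M s)) * M' i₀ i₁ := by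
  have hd := (differentiable_pfaffian_of (n := n) (M s)).hasFDerivAt
  refine ⟨_, hd.comp_hasDerivAt s hM, ?_⟩
  set D := fderiv ℝ (fun A : Fin (2 * n) → Fin (2 * n) → ℝ => pfaffian (Matrix.of A)) (M s)
  -- The derivative depends only on the velocity, so the curve may be replaced by its tangent line.
  -- Along the line `pfaffian_mul_eq_of_row` applies exactly and makes the Pfaffian times the entry
  -- at (i₀, i₁) affine in r.
  have hline : HasDerivAt (fun r : ℝ => M s + r • M') M' 0 := by
    simpa using ((hasDerivAt_id (0 : ℝ)).smul_const M').const_add (M s)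
  have hd0 : HasFDerivAt (fun A : Fin (2 * n) → Fin (2 * n) → ℝ => pfaffian (Matrix.of A)) D
      (M s + (0 : ℝ) • M') := by simpa using hd
  have h1 := (hd0.comp_hasDerivAt (0 : ℝ) hline).mul_const (M s i₀ i₁)
  have h2 : HasDerivAt (fun r : ℝ => pfaffian (Matrix.of (M s)) * (M s i₀ i₁ + r * M' i₀ i₁))
      (pfaffian (Matrix.of (M s)) * M' i₀ i₁) 0 := by
    simpa using (((hasDerivAt_id (0 : ℝ)).mul_const (M' i₀ i₁)).const_add (M s i₀ i₁)).const_mul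
      (pfaffian (Matrix.of (M s)))
  have heq : (fun r : ℝ => ((fun A : Fin (2 * n) → Fin (2 * n) → ℝ => pfaffian (Matrix.of A)) ∘
      fun r : ℝ => M s + r • M') r * M s i₀ i₁) =
      fun r : ℝ => pfaffian (Matrix.of (M s)) * (M s i₀ i₁ + r * M' i₀ i₁) := by
    funext r
    have := pfaffian_mul_eq_of_row (Matrix.of (M s + r • M')) (Matrix.of (M s))
      (fun i j => by simp [hsk i j, hsk' i j]; ring) (fun i j => by simpa using hsk i j)
      (i₀ := i₀) (i₁ := i₁)
      (fun j hj => by simp [h0 j hj, h0' i₀ j hi hj]) (fun j hj => by simp [h0 j hj])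
      (fun i j _ hi1 _ hj1 => by simp [h0' i j hi1 hj1])
    simpa using this
  rw [heq] at h1
  rw [mul_comm]
  exact h1.unique h2

variable {E : Type*} [NormedAddCommGroup E] [NormedSpace ℝ E]

/-- The frame along a curve `γ` which is transported by the linearization of `V` to first order at
`s₀`, with the vector at `i₀` equal to `V`. -/
def transportedFrame (V : E → E) (γ : ℝ → E) (b : Fin (2 * n) → E) (i₀ : Fin (2 * n)) (s₀ s : ℝ) :
    Fin (2 * n) → E :=
  fun j => if j = i₀ then V (γ s) else b j + (s - s₀) • fderiv ℝ V (γ s₀) (b j)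

variable {V : E → E} {γ : ℝ → E} {b : Fin (2 * n) → E} {i₀ i₁ : Fin (2 * n)} {s₀ : ℝ}

theorem transportedFrame_self (hb : b i₀ = V (γ s₀)) : transportedFrame V γ b i₀ s₀ s₀ = b := by
  funext j
  by_cases h : j = i₀
  · simp [transportedFrame, h, hb]
  · simp [transportedFrame, h]

/-- For j = i₀ the chain rule along the integral curve gives DV(V), consistent with linear
transport. Keeping this member exactly equal to V makes the contraction relation available at nearby
times. -/
theorem hasDerivAt_transportedFrame (hb : b i₀ = V (γ s₀)) (hγ : HasDerivAt γ (V (γ s₀)) s₀)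
    (hV : DifferentiableAt ℝ V (γ s₀)) (j : Fin (2 * n)) :
    HasDerivAt (fun s => transportedFrame V γ b i₀ s₀ s j) (fderiv ℝ V (γ s₀) (b j)) s₀ := by
  by_cases h : j = i₀
  · simp only [transportedFrame, h, if_true, hb]
    exact hV.hasFDerivAt.comp_hasDerivAt s₀ hγ
  · simp only [transportedFrame, h, if_false]
    simpa using (((hasDerivAt_id s₀).sub_const s₀).smul_const (fderiv ℝ V (γ s₀) (b j))).const_add
      (b j)

variable {B : E → E →L[ℝ] E →L[ℝ] ℝ} {H c : E → ℝ}

/-- Along an integral curve of `V` on the level set of `H`, the Pfaffian of a closed two-form with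
`ι_V B = c dH` in a transported frame changes at the logarithmic rate of `c`. -/
theorem hasDerivAt_pfaffian_transportedFrame [CompleteSpace E] (hB : ContDiffAt ℝ 1 B (γ s₀))
    (hskew : ∀ᶠ z in 𝓝 (γ s₀), ∀ u w, B z u w = -B z w u)
    (hcl : ∀ u v w, fderiv ℝ B (γ s₀) u v w - fderiv ℝ B (γ s₀) v u w +
      fderiv ℝ B (γ s₀) w u v = 0)
    (hV : ContDiffAt ℝ 1 V (γ s₀)) (hH : ContDiffAt ℝ 2 H (γ s₀))
    (hc : ContDiffAt ℝ 1 c (γ s₀))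
    (hQ : ∀ᶠ z in 𝓝 (γ s₀), H z = H (γ s₀) → ∀ u, B z (V z) u = c z * fderiv ℝ H z u)
    (hHV : ∀ᶠ z in 𝓝 (γ s₀), fderiv ℝ H z (V z) = 0)
    (hγ : HasDerivAt γ (V (γ s₀)) s₀) (hγH : ∀ᶠ s in 𝓝 s₀, H (γ s) = H (γ s₀))
    (hb : b i₀ = V (γ s₀)) (hi : i₀ ≠ i₁) (hb₁ : fderiv ℝ H (γ s₀) (b i₁) ≠ 0)
    (hbj : ∀ j, j ≠ i₁ → fderiv ℝ H (γ s₀) (b j) = 0) :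
    ∃ X' : ℝ, HasDerivAt (fun s => pfaffian (Matrix.of fun i j =>
        B (γ s) (transportedFrame V γ b i₀ s₀ s i) (transportedFrame V γ b i₀ s₀ s j))) X' s₀ ∧
      c (γ s₀) * X' = pfaffian (Matrix.of fun i j => B (γ s₀) (b i) (b j)) *
        fderiv ℝ c (γ s₀) (V (γ s₀)) := by
  set y := γ s₀ with hy
  set L := fderiv ℝ V y with hL
  have hH' : fderiv ℝ H y ≠ 0 := fun h => hb₁ (by rw [h]; rfl)
  have hdB := (hB.differentiableAt one_ne_zero).hasFDerivAt
  have hdc := (hc.differentiableAt one_ne_zero).hasFDerivAt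
  have hdH1 : ContDiffAt ℝ 1 (fderiv ℝ H) y := hH.fderiv_right (by norm_num)
  have hdH := (hdH1.differentiableAt one_ne_zero).hasFDerivAt
  have hdV := (hV.differentiableAt one_ne_zero).hasFDerivAt
  have hfr := hasDerivAt_transportedFrame hb hγ (hV.differentiableAt one_ne_zero)
  have hself := transportedFrame_self (s₀ := s₀) hb
  set f := transportedFrame V γ b i₀ s₀ with hf
  set M : ℝ → Fin (2 * n) → Fin (2 * n) → ℝ := fun s i j => B (γ s) (f s i) (f s j) with hM
  set M' : Fin (2 * n) → Fin (2 * n) → ℝ := fun i j =>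
    fderiv ℝ B y (V y) (b i) (b j) + B y (L (b i)) (b j) + B y (b i) (L (b j)) with hM'
  have hMs : ∀ i j, M s₀ i j = B y (b i) (b j) := fun i j => by simp [hM, hself, hy]
  have hMd : ∀ i j, HasDerivAt (fun s => M s i j) (M' i j) s₀ := by
    intro i j
    have h1 := ((hdB.comp_hasDerivAt s₀ hγ).clm_apply (hfr i)).clm_apply (hfr j)
    refine h1.congr_deriv ?_
    simp [hM', hself, hy]
    rfl
  have hMD : HasDerivAt M M' s₀ :=
    hasDerivAt_pi.2 fun i => hasDerivAt_pi.2 fun j => hMd i j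
  have hskM : ∀ᶠ s in 𝓝 s₀, ∀ i j, M s i j = -M s j i := by
    filter_upwards [hγ.continuousAt.eventually hskew] with s hs i j using hs _ _
  have hrow : ∀ᶠ s in 𝓝 s₀, ∀ j, M s i₀ j = c (γ s) * fderiv ℝ H (γ s) (f s j) := by
    filter_upwards [hγ.continuousAt.eventually hQ, hγH] with s h1 h2 j
    have : f s i₀ = V (γ s) := by simp [hf, transportedFrame]
    simp only [hM, this]
    exact h1 h2 _
  -- Differentiating dH(V) = 0 shows that dH of a transported vector is constant to first order.
  have hlin : ∀ u, fderiv ℝ (fderiv ℝ H) y (V y) u + fderiv ℝ H y (L u) = 0 := by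
    intro u
    have h1 := (hdH.clm_apply hdV).congr_of_eventuallyEq
      (f₁ := fun _ => (0 : ℝ)) (hHV.mono fun z hz => hz.symm)
    have h2 := congrArg (fun l => l u) ((hasFDerivAt_const (0 : ℝ) y).unique h1)
    have h3 : fderiv ℝ (fderiv ℝ H) y (V y) u = fderiv ℝ (fderiv ℝ H) y u (V y) :=
      (hH.isSymmSndFDerivAt (by simp)).eq _ _
    rw [h3]
    simp at h2
    rw [add_comm]
    exact h2.symm
  have hrow' : ∀ j, M' i₀ j = fderiv ℝ c y (V y) * fderiv ℝ H y (b j) := by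
    intro j
    have h1 := (hdc.comp_hasDerivAt s₀ hγ).fun_mul
      ((hdH.comp_hasDerivAt s₀ hγ).clm_apply (hfr j))
    have h2 := h1.congr_of_eventuallyEq (f₁ := fun s => M s i₀ j)
      (hrow.mono fun s hs => hs j)
    have h3 := (hMd i₀ j).unique h2
    rw [h3]
    have := hlin (b j)
    simp only [Function.comp_apply, hself, ← hy]
    linear_combination c y * this
  obtain ⟨X', hX, hX'⟩ := hasDerivAt_pfaffian_of_row (i₀ := i₀) (i₁ := i₁) hMD
    hskM.self_of_nhds
    (fun i j => (hMd i j).unique (((hMd j i).fun_neg).congr_of_eventuallyEq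
      (hskM.mono fun s hs => hs i j)))
    (fun j hj => by
      rw [hrow.self_of_nhds j, hself, ← hy, hbj j hj, mul_zero])
    (fun i j hi1 hj1 => lieDeriv_eq_zero_of_contraction hB hskew hcl hV hH hH' hc hQ
      (hbj i hi1) (hbj j hj1)) hi
  refine ⟨X', hX, ?_⟩
  have e1 : M s₀ i₀ i₁ = c y * fderiv ℝ H y (b i₁) := by
    rw [hrow.self_of_nhds i₁, hself]
  have e2 : pfaffian (Matrix.of (M s₀)) = pfaffian (Matrix.of fun i j => B y (b i) (b j)) := by
    congr 1
    ext i j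
    exact hMs i j
  rw [e1, hrow', e2] at hX'
  refine mul_right_cancel₀ hb₁ ?_
  linear_combination hX'

/-- The quotient of the Pfaffians of `σ - t τ` and `τ` by `t - a` is constant to first order along
an integral curve. -/
theorem deriv_eq_zero_of_pfaffian_factorization [CompleteSpace E]
    (b₀ : Module.Basis (Fin (2 * n)) ℝ E)
    {τ σ : E → E →L[ℝ] E →L[ℝ] ℝ} {a : E → ℝ}
    (hτ : ContDiffAt ℝ 1 τ (γ s₀)) (hσ : ContDiffAt ℝ 1 σ (γ s₀))
    (hskτ : ∀ᶠ z in 𝓝 (γ s₀), ∀ u w, τ z u w = -τ z w u)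
    (hskσ : ∀ᶠ z in 𝓝 (γ s₀), ∀ u w, σ z u w = -σ z w u)
    (hclτ : ∀ u v w, fderiv ℝ τ (γ s₀) u v w - fderiv ℝ τ (γ s₀) v u w +
      fderiv ℝ τ (γ s₀) w u v = 0)
    (hclσ : ∀ u v w, fderiv ℝ σ (γ s₀) u v w - fderiv ℝ σ (γ s₀) v u w +
      fderiv ℝ σ (γ s₀) w u v = 0)
    (hV : ContDiffAt ℝ 1 V (γ s₀)) (hH : ContDiffAt ℝ 2 H (γ s₀))
    (hH' : fderiv ℝ H (γ s₀) ≠ 0) (ha : ContDiffAt ℝ 1 a (γ s₀))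
    (hVτ : ∀ᶠ z in 𝓝 (γ s₀), ∀ u, τ z (V z) u = -fderiv ℝ H z u)
    (hVσ : ∀ᶠ z in 𝓝 (γ s₀), H z = H (γ s₀) → ∀ u, σ z (V z) u = -(a z) * fderiv ℝ H z u)
    (hγ : HasDerivAt γ (V (γ s₀)) s₀) (hγH : ∀ᶠ s in 𝓝 s₀, H (γ s) = H (γ s₀))
    (hnd : ∀ u, (∀ w, τ (γ s₀) u w = 0) → u = 0)
    {t p' : ℝ} {p : ℝ → ℝ} (hp : HasDerivAt p p' s₀) (ht : t ≠ a (γ s₀))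
    (hfac : ∀ᶠ s in 𝓝 s₀, ∀ m : Fin (2 * n) → E,
      pfaffian (Matrix.of fun i j => (σ (γ s) - t • τ (γ s)) (m i) (m j)) =
        pfaffian (Matrix.of fun i j => τ (γ s) (m i) (m j)) * (t - a (γ s)) * p s) :
    p' = 0 := by
  have hαne : (fderiv ℝ H (γ s₀)).toLinearMap ≠ 0 := fun h =>
    hH' (ContinuousLinearMap.ext fun x => congrArg (fun l => l x) h)
  have hHV : ∀ᶠ z in 𝓝 (γ s₀), fderiv ℝ H z (V z) = 0 := by
    filter_upwards [hVτ, hskτ] with z h1 h2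
    have := h1 (V z)
    have := h2 (V z) (V z)
    linarith
  have hVne : V (γ s₀) ≠ 0 := by
    intro h
    apply hH'
    ext u
    have := hVτ.self_of_nhds u
    rw [h] at this
    simpa using this.symm
  obtain ⟨b, i₀, i₁, hi, hb, hb₁, hbj⟩ := exists_basis_adapted b₀ _ hαne hVne
    hHV.self_of_nhds
  have hdτ := (hτ.differentiableAt one_ne_zero)
  have hdσ := (hσ.differentiableAt one_ne_zero)
  obtain ⟨Y', hY, hY'⟩ := hasDerivAt_pfaffian_transportedFrame (c := fun _ => (-1 : ℝ)) hτ hskτ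
    hclτ hV hH contDiffAt_const (hVτ.mono fun z hz _ u => by rw [hz u]; ring) hHV hγ hγH hb hi hb₁
    hbj
  have hη : ContDiffAt ℝ 1 (fun z => σ z - t • τ z) (γ s₀) := hσ.sub (hτ.const_smul t)
  have hfη : ∀ u v w, fderiv ℝ (fun z => σ z - t • τ z) (γ s₀) u v w =
      fderiv ℝ σ (γ s₀) u v w - t * fderiv ℝ τ (γ s₀) u v w := by
    intro u v w
    rw [(hdσ.hasFDerivAt.fun_sub (hdτ.hasFDerivAt.fun_const_smul t)).fderiv]
    rfl
  obtain ⟨X', hX, hX'⟩ := hasDerivAt_pfaffian_transportedFrame (c := fun z => t - a z) hη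
    (by
      filter_upwards [hskτ, hskσ] with z h1 h2 u w
      simp [h1 u w, h2 u w]; ring)
    (by
      intro u v w
      rw [hfη, hfη, hfη]
      have h1 := hclτ u v w
      have h2 := hclσ u v w
      linear_combination h2 - t * h1)
    hV hH (contDiffAt_const.sub ha)
    (by
      filter_upwards [hVτ, hVσ] with z h1 h2 h3 u
      simp [h1 u, h2 h3 u]; ring) hHV hγ hγH hb hi hb₁ hbj
  have hda := (ha.differentiableAt one_ne_zero).hasFDerivAt
  have hc' : fderiv ℝ (fun z => t - a z) (γ s₀) = -fderiv ℝ a (γ s₀) :=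
    (hda.const_sub t).fderiv
  have hY0 : Y' = 0 := by simpa using hY'
  -- The Pfaffian of σ - tτ is differentiated a second time, through the factorization. As Y' = 0,
  -- the da terms match those of hX', and Pf(τ)(t - a)² p' = 0 is left.
  have hprod := (hY.fun_mul (((hda.comp_hasDerivAt s₀ hγ)).const_sub t)).fun_mul hp
  have hXeq := hX.unique (hprod.congr_of_eventuallyEq (hfac.mono fun s hs => hs _))
  have hself := transportedFrame_self (s₀ := s₀) hb
  simp only [hself, Function.comp_apply, hY0, zero_mul, zero_add] at hXeq
  have hf0 := hfac.self_of_nhds b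
  rw [hc', hf0, hXeq] at hX'
  have hYne : pfaffian (Matrix.of fun i j => τ (γ s₀) (b i) (b j)) ≠ 0 := by
    refine bilinPfaffian_ne_zero_of_nondegenerate
      (LinearMap.mk₂ ℝ (fun u w => τ (γ s₀) u w) (by simp) (by simp) (by simp) (by simp)) b ?_ hnd
    intro u
    have := hskτ.self_of_nhds u u
    simp only [LinearMap.mk₂_apply]
    linarith
  have htne : t - a (γ s₀) ≠ 0 := sub_ne_zero.2 ht
  simp only [neg_apply] at hX'
  have h9 : pfaffian (Matrix.of fun i j => τ (γ s₀) (b i) (b j)) * (t - a (γ s₀)) ^ 2 * p' = 0 := by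
    linear_combination hX'
  rcases mul_eq_zero.1 h9 with h | h
  · exact absurd h (mul_ne_zero hYne (pow_ne_zero 2 htne))
  · exact h

end FrameAlongCurve

/-! ### Vector fields and curves in charts -/

section ChartVector

variable {d : ℕ} {M : Type*} [TopologicalSpace M] [ChartedSpace (EuclideanSpace ℝ (Fin d)) M]

/-- The coordinate expression of a tangent vector at `x` in the preferred chart at `x₀`. -/
def chartVec (x₀ x : M) : TangentSpace (𝓡 d) x →L[ℝ] EuclideanSpace ℝ (Fin d) :=
  mfderiv (𝓡 d) 𝓘(ℝ, EuclideanSpace ℝ (Fin d)) (extChartAt (𝓡 d) x₀) x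

variable [IsManifold (𝓡 d) ∞ M]

theorem contMDiffOn_chartVec {v : ∀ x : M, TangentSpace (𝓡 d) x}
    (hv : ContMDiff (𝓡 d) (𝓡 d).tangent ∞ (fun x => (⟨x, v x⟩ : TangentBundle (𝓡 d) M)))
    (x₀ : M) : ContMDiffOn (𝓡 d) 𝓘(ℝ, EuclideanSpace ℝ (Fin d)) ∞ (fun x => chartVec x₀ x (v x))
      (extChartAt (𝓡 d) x₀).source := by
  have h1 := (trivializationAt (EuclideanSpace ℝ (Fin d))
    (TangentSpace (𝓡 d) : M → Type _) x₀).contMDiffOn_section_baseSet_iff (n := ∞) (s := v)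
    (IB := 𝓡 d) |>.1 hv.contMDiffOn
  rw [extChartAt_source]
  refine h1.congr fun x hx => ?_
  have h2 := congrArg (fun l => l (v x))
    (TangentBundle.continuousLinearMapAt_trivializationAt (I := 𝓡 d) (x₀ := x₀) hx)
  refine Eq.trans h2.symm ?_
  change (trivializationAt (EuclideanSpace ℝ (Fin d)) (TangentSpace (𝓡 d)) x₀).linearMapAt ℝ x _ = _
  rw [Bundle.Trivialization.coe_linearMapAt_of_mem _ hx]

theorem hasDerivAt_extChartAt_comp {γ : ℝ → M} {t : ℝ} {u : TangentSpace (𝓡 d) (γ t)} {x₀ : M}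
    (hγ : HasMFDerivAt 𝓘(ℝ, ℝ) (𝓡 d) γ t ((1 : ℝ →L[ℝ] ℝ).smulRight u))
    (hs : γ t ∈ (extChartAt (𝓡 d) x₀).source) :
    HasDerivAt (extChartAt (𝓡 d) x₀ ∘ γ) (chartVec x₀ (γ t) u) t := by
  rw [extChartAt_source] at hs
  have h1 := HasMFDerivAt.comp t (mdifferentiableAt_extChartAt (I := 𝓡 d) hs).hasMFDerivAt hγ
  have h2 : HasMFDerivAt 𝓘(ℝ, ℝ) 𝓘(ℝ, EuclideanSpace ℝ (Fin d)) (extChartAt (𝓡 d) x₀ ∘ γ) t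
      (ContinuousLinearMap.toSpanSingleton ℝ (chartVec x₀ (γ t) u)) := by
    refine h1.congr_mfderiv (ContinuousLinearMap.ext fun r => ?_)
    exact ContinuousLinearMap.map_smul (chartVec x₀ (γ t)) r u
  exact hasMFDerivAt_iff_hasFDerivAt.1 h2
end ChartVector

/-! ### Curves contained in one trajectory -/

section TrajectoryDirection

variable {d : ℕ} {M : Type*} [TopologicalSpace M] [ChartedSpace (EuclideanSpace ℝ (Fin d)) M]
  [IsManifold (𝓡 d) ∞ M]

theorem eqOn_of_isMIntegralCurveOn_Ioo_of_eq_zero [T2Space M]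
    {v : ∀ x : M, TangentSpace (𝓡 d) x}
    (hv : ContMDiff (𝓡 d) (𝓡 d).tangent ∞ (fun x => (⟨x, v x⟩ : TangentBundle (𝓡 d) M)))
    {γ δ : ℝ → M} {α β α' β' s : ℝ} (h0 : 0 ∈ Ioo α β) (h0' : 0 ∈ Ioo α' β') (hs : s ∈ Ioo α β)
    (hs' : s ∈ Ioo α' β')
    (hγ : IsMIntegralCurveOn (I := 𝓡 d) γ v (Ioo α β))
    (hδ : IsMIntegralCurveOn (I := 𝓡 d) δ v (Ioo α' β')) (h : γ 0 = δ 0) : γ s = δ s := by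
  have : IsManifold (𝓡 d) 1 M := IsManifold.of_le (n := ∞) (by exact_mod_cast le_top)
  refine isMIntegralCurveOn_Ioo_eqOn_of_contMDiff_boundaryless (I := 𝓡 d) (v := v)
    (a := max α α') (b := min β β') (t₀ := 0)
    ⟨max_lt h0.1 h0'.1, lt_min h0.2 h0'.2⟩ (hv.of_le (by exact_mod_cast le_top))
    (hγ.mono ?_) (hδ.mono ?_) h ⟨max_lt hs.1 hs'.1, lt_min hs.2 hs'.2⟩
  · exact Ioo_subset_Ioo (le_max_left _ _) (min_le_left _ _)
  · exact Ioo_subset_Ioo (le_max_right _ _) (min_le_right _ _)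

/-- The map is the differential of (t, s) ↦ c(t) - δ(s) for curves with velocities y and x; its
injectivity isolates the coincidences of transverse curves. -/
theorem injective_smul_sub_smul {E : Type*} [NormedAddCommGroup E] [NormedSpace ℝ E] {x y : E}
    (h : LinearIndependent ℝ ![x, y]) : LinearMap.ker
      (((ContinuousLinearMap.fst ℝ ℝ ℝ).smulRight y -
        (ContinuousLinearMap.snd ℝ ℝ ℝ).smulRight x : ℝ × ℝ →L[ℝ] E) : ℝ × ℝ →ₗ[ℝ] E) = ⊥ := by
  rw [LinearMap.ker_eq_bot']
  rintro ⟨r, s⟩ hrs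
  have h1 : r • y - s • x = 0 := hrs
  have h2 := LinearIndependent.pair_iff.1 h (-s) r (by rw [← h1, neg_smul]; abel)
  simp_all

/-- A differentiable curve contained in the trajectory of a vector field is tangent to the field:
otherwise it would meet the trajectory in countably many parameters only. -/
theorem exists_smul_eq_of_eventually_mem_trajectory [T2Space M]
    {v : ∀ x : M, TangentSpace (𝓡 d) x}
    (hv : ContMDiff (𝓡 d) (𝓡 d).tangent ∞ (fun x => (⟨x, v x⟩ : TangentBundle (𝓡 d) M)))
    {c : ℝ → M} {w : ℝ → EuclideanSpace ℝ (Fin d)} (hc : ContinuousAt c 0)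
    (hcw : ∀ᶠ t in 𝓝 0, HasDerivAt (extChartAt (𝓡 d) (c 0) ∘ c) (w t) t) (hw : ContinuousAt w 0)
    (htr : ∀ᶠ t in 𝓝 (0 : ℝ), c t ∈ trajectory v (c 0))
    (hne : chartVec (c 0) (c 0) (v (c 0)) ≠ 0) :
    ∃ a : ℝ, w 0 = a • chartVec (c 0) (c 0) (v (c 0)) := by
  by_contra! hcon
  have hsrc : ∀ᶠ t in 𝓝 0, c t ∈ (extChartAt (𝓡 d) (c 0)).source :=
    hc.eventually (extChartAt_source_mem_nhds (I := 𝓡 d) (c 0))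
  have hVc : ContinuousAt (fun x => chartVec (c 0) x (v x)) (c 0) :=
    ((contMDiffOn_chartVec hv (c 0)).continuousOn).continuousAt
      (extChartAt_source_mem_nhds (I := 𝓡 d) (c 0))
  have hli0 : LinearIndependent ℝ ![chartVec (c 0) (c 0) (v (c 0)), w 0] :=
    (LinearIndependent.pair_iff' hne).2 fun a h => hcon a h.symm
  have hpair : ContinuousAt (fun t => ![chartVec (c 0) (c t) (v (c t)), w t]) 0 := by
    refine continuousAt_pi.2 fun i => ?_
    fin_cases i
    · exact ContinuousAt.comp (f := c) (g := fun x => chartVec (c 0) x (v x)) hVc hc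
    · exact hw
  have hli : ∀ᶠ t in 𝓝 0, LinearIndependent ℝ ![chartVec (c 0) (c t) (v (c t)), w t] :=
    hpair.eventually hli0.eventually
  obtain ⟨ε, hε, hball⟩ := Metric.eventually_nhds_iff_ball.1 (hsrc.and (hli.and (hcw.and htr)))
  rw [Real.ball_eq_Ioo, zero_sub, zero_add] at hball
  -- Z records the pairs (t, s) such that c(t) is reached at time s. Recording s as well makes the
  -- coincidences isolated, even when the trajectory returns near the same point at distant times.
  set Z : Set (ℝ × ℝ) := {z | z.1 ∈ Ioo (-ε) ε ∧ ∃ (δ : ℝ → M) (α β : ℝ), α < 0 ∧ 0 < β ∧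
    z.2 ∈ Ioo α β ∧ IsMIntegralCurveOn (I := 𝓡 d) δ v (Ioo α β) ∧ δ 0 = c 0 ∧ δ z.2 = c z.1}
    with hZ
  have hdisc : DiscreteTopology Z := by
    rw [discreteTopology_subtype_iff]
    rintro ⟨t, s⟩ ⟨ht, δ, α, β, hα, hβ, hs, hδ, hδ0, hδs⟩
    obtain ⟨hct, hlit, hdt, -⟩ := hball t ht
    have hδd : HasDerivAt (extChartAt (𝓡 d) (c 0) ∘ δ) (chartVec (c 0) (c t) (v (c t))) s := by
      have h1 := hasDerivAt_extChartAt_comp (x₀ := c 0) ((hδ s hs).hasMFDerivAt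
        (Ioo_mem_nhds hs.1 hs.2)) (by simp only at hδs; rw [hδs]; exact hct)
      simp only at hδs
      rwa [hδs] at h1
    have hG : HasFDerivAt (fun z : ℝ × ℝ => (extChartAt (𝓡 d) (c 0) ∘ c) z.1 -
        (extChartAt (𝓡 d) (c 0) ∘ δ) z.2)
        ((ContinuousLinearMap.fst ℝ ℝ ℝ).smulRight (w t) -
          (ContinuousLinearMap.snd ℝ ℝ ℝ).smulRight (chartVec (c 0) (c t) (v (c t)))) (t, s) := by
      have h1 := HasFDerivAt.comp (t, s) (f := Prod.fst) hdt.hasFDerivAt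
        (ContinuousLinearMap.fst ℝ ℝ ℝ).hasFDerivAt
      have h2 := HasFDerivAt.comp (t, s) (f := Prod.snd) hδd.hasFDerivAt
        (ContinuousLinearMap.snd ℝ ℝ ℝ).hasFDerivAt
      refine (h1.fun_sub h2).congr_fderiv ?_
      ext <;> simp
    obtain ⟨K, -, hK⟩ := LinearMap.exists_antilipschitzWith _ (injective_smul_sub_smul hlit)
    have hne' := hG.eventually_ne (c := 0) ⟨K, hK⟩
    have hnear : ∀ᶠ z : ℝ × ℝ in 𝓝[≠] (t, s), z.2 ∈ Ioo α β :=
      (continuous_snd.continuousAt.eventually (Ioo_mem_nhds hs.1 hs.2)).filter_mono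
        nhdsWithin_le_nhds
    rw [Filter.inf_principal_eq_bot]
    filter_upwards [hne', hnear] with z hz1 hz2
    rintro ⟨hz3, δ', α', β', hα', hβ', hs', hδ', hδ0', hδs'⟩
    apply hz1
    -- A nearby point of Z may come with another integral curve; uniqueness replaces it by δ, so one
    -- local function governs all of them.
    have := eqOn_of_isMIntegralCurveOn_Ioo_of_eq_zero hv ⟨hα, hβ⟩ ⟨hα', hβ'⟩ hz2 hs' hδ hδ'
      (hδ0.trans hδ0'.symm)
    simp only [Function.comp_apply]
    rw [this, hδs', sub_self]
  -- A discrete subset of the plane is countable, yet Z projects onto an interval.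
  have hcount : Z.Countable := Set.countable_coe_iff.1
    (TopologicalSpace.separableSpace_iff_countable.1 inferInstance)
  have hsub : Ioo (-ε) ε ⊆ Prod.fst '' Z := by
    intro t ht
    obtain ⟨δ, α, β, s, hα, hβ, hs, hδ, hδ0, hδs⟩ := (hball t ht).2.2.2
    exact ⟨(t, s), ⟨ht, δ, α, β, hα, hβ, hs, hδ, hδ0, hδs⟩, rfl⟩
  have := Cardinal.Real.Ioo_countable_iff.1 ((hcount.image Prod.fst).mono hsub)
  linarith

end TrajectoryDirection

/-! ### Symplectic forms and their pullbacks in charts -/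

section FormsInCharts

variable {d : ℕ} {M : Type*} [TopologicalSpace M] [ChartedSpace (EuclideanSpace ℝ (Fin d)) M]

theorem inChart_apply (η : TwoForm d M) (x₀ : M) (y u w : EuclideanSpace ℝ (Fin d)) :
    η.inChart x₀ y ![u, w] = η ((extChartAt (𝓡 d) x₀).symm y)
      ![mfderiv (𝓡 d) (𝓡 d) (extChartAt (𝓡 d) x₀).symm y u,
        mfderiv (𝓡 d) (𝓡 d) (extChartAt (𝓡 d) x₀).symm y w] := by
  refine congrArg (η ((extChartAt (𝓡 d) x₀).symm y)) (?_ : (fun i =>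
    mfderiv (𝓡 d) (𝓡 d) (extChartAt (𝓡 d) x₀).symm y (![u, w] i)) = _)
  funext i
  fin_cases i <;> rfl

/-- The two-form is smooth near `x₀` and closed at `x₀`, expressed through its bilinear coordinate
expression in the preferred chart at `x₀`. -/
structure IsClosedFormAt (η : TwoForm d M) (x₀ : M) : Prop where
  smooth : ∃ W : Set (EuclideanSpace ℝ (Fin d)), IsOpen W ∧ extChartAt (𝓡 d) x₀ x₀ ∈ W ∧
    W ⊆ (extChartAt (𝓡 d) x₀).target ∧
    ContDiffOn ℝ ∞ (fun y => twoFormCLM (EuclideanSpace ℝ (Fin d)) (η.inChart x₀ y)) W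
  cyclic : ∀ u v w : EuclideanSpace ℝ (Fin d),
    fderiv ℝ (fun y => twoFormCLM _ (η.inChart x₀ y)) (extChartAt (𝓡 d) x₀ x₀) u v w -
    fderiv ℝ (fun y => twoFormCLM _ (η.inChart x₀ y)) (extChartAt (𝓡 d) x₀ x₀) v u w +
    fderiv ℝ (fun y => twoFormCLM _ (η.inChart x₀ y)) (extChartAt (𝓡 d) x₀ x₀) w u v = 0

theorem contDiffOn_twoFormCLM_comp {E : Type*} [NormedAddCommGroup E] [NormedSpace ℝ E]
    {m : WithTop ℕ∞} {η : E → E [⋀^Fin 2]→L[ℝ] ℝ} {s : Set E} (hη : ContDiffOn ℝ m η s) :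
    ContDiffOn ℝ m (fun y => twoFormCLM E (η y)) s :=
  ContDiff.comp_contDiffOn (𝕜 := ℝ) (F := E [⋀^Fin 2]→L[ℝ] ℝ) (G := E →L[ℝ] E →L[ℝ] ℝ)
    (ContinuousLinearMap.contDiff (𝕜 := ℝ) (E := E [⋀^Fin 2]→L[ℝ] ℝ) (F := E →L[ℝ] E →L[ℝ] ℝ)
      (twoFormCLM E)) hη

theorem IsSymplecticForm.isClosedFormAt {Ω : TwoForm d M} (hΩ : IsSymplecticForm Ω) (x₀ : M) :
    IsClosedFormAt Ω x₀ where
  smooth := ⟨_, isOpen_extChartAt_target x₀, mem_extChartAt_target x₀, Subset.rfl,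
    contDiffOn_twoFormCLM_comp (hΩ.smooth x₀)⟩
  cyclic := fderiv_twoFormCLM_cyclic
    ((hΩ.smooth x₀).contDiffAt ((isOpen_extChartAt_target x₀).mem_nhds (mem_extChartAt_target x₀))
      |>.differentiableAt (by simp)) (hΩ.closed x₀ _ (mem_extChartAt_target x₀))

/-- The point occurs in the type of the tangent space, so replacing it by an equal one cannot be
done by rewriting alone. -/
theorem compContinuousLinearMap_congr_point (η : TwoForm d M) {p q : M} (h : p = q)
    (A : EuclideanSpace ℝ (Fin d) →L[ℝ] TangentSpace (𝓡 d) p)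
    (B : EuclideanSpace ℝ (Fin d) →L[ℝ] TangentSpace (𝓡 d) q) (hAB : ∀ u, A u = B u) :
    (η p).compContinuousLinearMap A = (η q).compContinuousLinearMap B := by
  subst h
  rw [ContinuousLinearMap.ext hAB]

variable [IsManifold (𝓡 d) ∞ M]

theorem contMDiffAt_extChartAt_symm_of_mem {x₀ : M} {y : EuclideanSpace ℝ (Fin d)}
    (hy : y ∈ (extChartAt (𝓡 d) x₀).target) :
    ContMDiffAt (𝓡 d) (𝓡 d) ∞ (extChartAt (𝓡 d) x₀).symm y :=
  (contMDiffOn_extChartAt_symm x₀).contMDiffAt ((isOpen_extChartAt_target x₀).mem_nhds hy)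

theorem mdifferentiableAt_extChartAt_symm_of_mem {x₀ : M} {y : EuclideanSpace ℝ (Fin d)}
    (hy : y ∈ (extChartAt (𝓡 d) x₀).target) :
    MDifferentiableAt (𝓡 d) (𝓡 d) (extChartAt (𝓡 d) x₀).symm y :=
  (contMDiffAt_extChartAt_symm_of_mem hy).mdifferentiableAt (by simp)

theorem mfderiv_extChartAt_symm_chartVec {x₀ : M} {y : EuclideanSpace ℝ (Fin d)}
    (hy : y ∈ (extChartAt (𝓡 d) x₀).target)
    (u : TangentSpace (𝓡 d) ((extChartAt (𝓡 d) x₀).symm y)) :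
    mfderiv (𝓡 d) (𝓡 d) (extChartAt (𝓡 d) x₀).symm y
      (chartVec x₀ ((extChartAt (𝓡 d) x₀).symm y) u) = u := by
  have : IsManifold (𝓡 d) 1 M := IsManifold.of_le (n := ∞) (by exact_mod_cast le_top)
  have h := mfderivWithin_extChartAt_symm_comp_mfderiv_extChartAt (I := 𝓡 d) hy
  rw [ModelWithCorners.range_eq_univ, mfderivWithin_univ] at h
  exact congrArg (fun l => l u) h

theorem chartVec_mfderiv_extChartAt_symm {x₀ : M} {y : EuclideanSpace ℝ (Fin d)}
    (hy : y ∈ (extChartAt (𝓡 d) x₀).target) (u : EuclideanSpace ℝ (Fin d)) :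
    chartVec x₀ ((extChartAt (𝓡 d) x₀).symm y)
      (mfderiv (𝓡 d) (𝓡 d) (extChartAt (𝓡 d) x₀).symm y u) = u := by
  have : IsManifold (𝓡 d) 1 M := IsManifold.of_le (n := ∞) (by exact_mod_cast le_top)
  have h := mfderiv_extChartAt_comp_mfderivWithin_extChartAt_symm (I := 𝓡 d) hy
  rw [ModelWithCorners.range_eq_univ, mfderivWithin_univ] at h
  exact congrArg (fun l => l u) h

theorem chartVec_ne_zero {x₀ x : M} (hx : x ∈ (extChartAt (𝓡 d) x₀).source)
    {u : TangentSpace (𝓡 d) x} (hu : u ≠ 0) : chartVec x₀ x u ≠ 0 := by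
  have : IsManifold (𝓡 d) 1 M := IsManifold.of_le (n := ∞) (by exact_mod_cast le_top)
  intro h
  exact hu ((isInvertible_mfderiv_extChartAt (I := 𝓡 d) hx).injective
    (h.trans (map_zero (chartVec x₀ x)).symm))

theorem fderiv_comp_extChartAt_symm {H : M → ℝ} (hH : ContMDiff (𝓡 d) 𝓘(ℝ) ∞ H) {x₀ : M}
    {y : EuclideanSpace ℝ (Fin d)} (hy : y ∈ (extChartAt (𝓡 d) x₀).target)
    (u : EuclideanSpace ℝ (Fin d)) :
    fderiv ℝ (H ∘ (extChartAt (𝓡 d) x₀).symm) y u =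
      differential H ((extChartAt (𝓡 d) x₀).symm y)
        (mfderiv (𝓡 d) (𝓡 d) (extChartAt (𝓡 d) x₀).symm y u) := by
  have h := mfderiv_comp (I := 𝓡 d) (I' := 𝓡 d) (I'' := 𝓘(ℝ)) y
    (hH.contMDiffAt.mdifferentiableAt (by simp)) (mdifferentiableAt_extChartAt_symm_of_mem hy)
  rw [mfderiv_eq_fderiv] at h
  exact congrArg (fun l => l u) h

theorem contDiffOn_comp_extChartAt_symm {H : M → ℝ} (hH : ContMDiff (𝓡 d) 𝓘(ℝ) ∞ H) (x₀ : M) :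
    ContDiffOn ℝ ∞ (H ∘ (extChartAt (𝓡 d) x₀).symm) (extChartAt (𝓡 d) x₀).target :=
  contMDiffOn_iff_contDiffOn.1 (hH.comp_contMDiffOn (contMDiffOn_extChartAt_symm x₀))

/-- The coordinate expression of a vector field in the preferred chart at `x₀`. -/
def fieldInChart (v : ∀ x : M, TangentSpace (𝓡 d) x) (x₀ : M) (y : EuclideanSpace ℝ (Fin d)) :
    EuclideanSpace ℝ (Fin d) :=
  chartVec x₀ ((extChartAt (𝓡 d) x₀).symm y) (v ((extChartAt (𝓡 d) x₀).symm y))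

theorem contDiffOn_fieldInChart {v : ∀ x : M, TangentSpace (𝓡 d) x}
    (hv : ContMDiff (𝓡 d) (𝓡 d).tangent ∞ (fun x => (⟨x, v x⟩ : TangentBundle (𝓡 d) M)))
    (x₀ : M) : ContDiffOn ℝ ∞ (fieldInChart v x₀) (extChartAt (𝓡 d) x₀).target :=
  contMDiffOn_iff_contDiffOn.1 ((contMDiffOn_chartVec hv x₀).comp (contMDiffOn_extChartAt_symm x₀)
    (extChartAt (𝓡 d) x₀).mapsTo_symm)

theorem mfderiv_fieldInChart (v : ∀ x : M, TangentSpace (𝓡 d) x) {x₀ : M}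
    {y : EuclideanSpace ℝ (Fin d)} (hy : y ∈ (extChartAt (𝓡 d) x₀).target) :
    mfderiv (𝓡 d) (𝓡 d) (extChartAt (𝓡 d) x₀).symm y (fieldInChart v x₀ y) =
      v ((extChartAt (𝓡 d) x₀).symm y) :=
  mfderiv_extChartAt_symm_chartVec hy _

theorem hasDerivAt_extChartAt_comp_fieldInChart {v : ∀ x : M, TangentSpace (𝓡 d) x} {γ : ℝ → M}
    {t : ℝ} {x₀ : M}
    (hγ : HasMFDerivAt 𝓘(ℝ, ℝ) (𝓡 d) γ t ((1 : ℝ →L[ℝ] ℝ).smulRight (v (γ t))))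
    (hs : γ t ∈ (extChartAt (𝓡 d) x₀).source) :
    HasDerivAt (extChartAt (𝓡 d) x₀ ∘ γ) (fieldInChart v x₀ ((extChartAt (𝓡 d) x₀ ∘ γ) t)) t := by
  have h1 := hasDerivAt_extChartAt_comp hγ hs
  have h2 : ∀ z, z = γ t → chartVec x₀ z (v z) = chartVec x₀ (γ t) (v (γ t)) := by
    rintro _ rfl; rfl
  rw [← h2 _ ((extChartAt (𝓡 d) x₀).left_inv hs)] at h1
  exact h1

variable {N : Type*} [TopologicalSpace N]
  [ChartedSpace (EuclideanSpace ℝ (Fin d)) N] [IsManifold (𝓡 d) ∞ N]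

/-- The pullback of a symplectic form under a smooth map is smooth and closed. -/
theorem IsSymplecticForm.isClosedFormAt_pullback {Ω : TwoForm d N} (hΩ : IsSymplecticForm Ω)
    {Φ : M → N} {U : Set M} (hU : IsOpen U) (hΦ : ContMDiffOn (𝓡 d) (𝓡 d) ∞ Φ U) {x₀ : M}
    (hx₀ : x₀ ∈ U) : IsClosedFormAt (TwoForm.pullback Φ Ω) x₀ := by
  set φ := extChartAt (𝓡 d) x₀ with hφ
  set φ' := extChartAt (𝓡 d) (Φ x₀) with hφ'
  -- F is Φ in coordinates; on W the coordinate form of the pullback is the pullback by F of the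
  -- coordinate form, which reduces closedness to the naturality of d.
  set F : EuclideanSpace ℝ (Fin d) → EuclideanSpace ℝ (Fin d) := φ' ∘ Φ ∘ φ.symm with hF
  have hU' : IsOpen (U ∩ Φ ⁻¹' φ'.source) :=
    hΦ.continuousOn.isOpen_inter_preimage hU (isOpen_extChartAt_source (I := 𝓡 d) (Φ x₀))
  set W := φ.target ∩ φ.symm ⁻¹' (U ∩ Φ ⁻¹' φ'.source) with hW
  have hWo : IsOpen W := (continuousOn_extChartAt_symm x₀).isOpen_inter_preimage
    (isOpen_extChartAt_target x₀) hU'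
  have hWm : φ x₀ ∈ W := by
    refine ⟨mem_extChartAt_target x₀, ?_⟩
    simp only [mem_preimage, hφ, extChartAt_to_inv]
    exact ⟨hx₀, mem_extChartAt_source (I := 𝓡 d) (Φ x₀)⟩
  have hFs : ContDiffOn ℝ ∞ F W := by
    refine contMDiffOn_iff_contDiffOn.1 ?_
    refine (contMDiffOn_extChartAt (I := 𝓡 d) (x := Φ x₀)).comp
      (hΦ.comp ((contMDiffOn_extChartAt_symm x₀).mono inter_subset_left)
        (fun y hy => hy.2.1)) (fun y hy => ?_)
    have := hy.2.2
    rwa [mem_preimage, hφ', extChartAt_source] at this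
  have hFd : ∀ y ∈ W, DifferentiableAt ℝ F y := fun y hy =>
    (hFs.contDiffAt (hWo.mem_nhds hy)).differentiableAt (by simp)
  have hFt : ∀ y ∈ W, F y ∈ φ'.target := fun y hy => φ'.map_source hy.2.2
  have hinv : ∀ y ∈ W, φ'.symm (F y) = Φ (φ.symm y) := fun y hy => φ'.left_inv hy.2.2
  have hder : ∀ y ∈ W, ∀ u : EuclideanSpace ℝ (Fin d),
      mfderiv (𝓡 d) (𝓡 d) φ'.symm (F y) (fderiv ℝ F y u) =
        mfderiv (𝓡 d) (𝓡 d) Φ (φ.symm y) (mfderiv (𝓡 d) (𝓡 d) φ.symm y u) := by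
    intro y hy u
    have h1 := mfderiv_comp (I := 𝓡 d) (I' := 𝓡 d) (I'' := 𝓡 d) y
      (mdifferentiableAt_extChartAt_symm_of_mem (hFt y hy))
      (hFd y hy).mdifferentiableAt
    have h2 := mfderiv_comp (I := 𝓡 d) (I' := 𝓡 d) (I'' := 𝓡 d) y
      ((hΦ.contMDiffAt (hU.mem_nhds hy.2.1)).mdifferentiableAt (by simp))
      (mdifferentiableAt_extChartAt_symm_of_mem hy.1)
    have h3 : (φ'.symm ∘ F) =ᶠ[𝓝 y] (Φ ∘ φ.symm) :=
      Filter.eventuallyEq_of_mem (hWo.mem_nhds hy) fun z hz => hinv z hz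
    have h4 := h3.mfderiv_eq (I := 𝓡 d) (I' := 𝓡 d)
    rw [mfderiv_eq_fderiv] at h1
    have e1 := congrArg (fun l : EuclideanSpace ℝ (Fin d) →L[ℝ] EuclideanSpace ℝ (Fin d) => l u)
      h1
    have e2 := congrArg (fun l : EuclideanSpace ℝ (Fin d) →L[ℝ] EuclideanSpace ℝ (Fin d) => l u)
      h2
    have e4 := congrArg (fun l : EuclideanSpace ℝ (Fin d) →L[ℝ] EuclideanSpace ℝ (Fin d) => l u)
      h4
    exact (e1.symm.trans e4).trans e2
  have hpull : ∀ y ∈ W, (TwoForm.pullback Φ Ω).inChart x₀ y =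
      (Ω.inChart (Φ x₀) (F y)).compContinuousLinearMap (fderiv ℝ F y) := by
    intro y hy
    exact (compContinuousLinearMap_congr_point Ω (hinv y hy)
      ((mfderiv (𝓡 d) (𝓡 d) φ'.symm (F y)).comp (fderiv ℝ F y))
      ((mfderiv (𝓡 d) (𝓡 d) Φ (φ.symm y)).comp (mfderiv (𝓡 d) (𝓡 d) φ.symm y)) (hder y hy)).symm
  have hΩF : ContDiffOn ℝ ∞ (fun y => twoFormCLM _ (Ω.inChart (Φ x₀) (F y))) W :=
    (contDiffOn_twoFormCLM_comp (hΩ.smooth (Φ x₀))).comp hFs hFt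
  have hdF : ContDiffOn ℝ ∞ (fderiv ℝ F) W := hFs.fderiv_of_isOpen hWo (by simp)
  refine ⟨⟨W, hWo, hWm, inter_subset_left, ?_⟩, ?_⟩
  -- In finite dimension smoothness of the bilinear map may be tested on fixed pairs of vectors.
  · rw [contDiffOn_clm_apply]
    intro u
    rw [contDiffOn_clm_apply]
    intro w
    refine ContDiffOn.congr ((hΩF.clm_apply (hdF.clm_apply (contDiffOn_const (c := u)))).clm_apply
      (hdF.clm_apply (contDiffOn_const (c := w)))) fun y hy => ?_
    rw [hpull y hy, twoFormCLM_apply, twoFormCLM_apply,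
      ContinuousAlternatingMap.compContinuousLinearMap_apply]
    congr 1
    ext i
    fin_cases i <;> rfl
  · have hev : (TwoForm.pullback Φ Ω).inChart x₀ =ᶠ[𝓝 (φ x₀)]
        fun y => (Ω.inChart (Φ x₀) (F y)).compContinuousLinearMap (fderiv ℝ F y) :=
      Filter.eventuallyEq_of_mem (hWo.mem_nhds hWm) hpull
    have hFx : ContDiffAt ℝ ∞ F (φ x₀) := hFs.contDiffAt (hWo.mem_nhds hWm)
    have hΩd : DifferentiableAt ℝ (Ω.inChart (Φ x₀)) (F (φ x₀)) :=
      ((hΩ.smooth (Φ x₀)).contDiffAt ((isOpen_extChartAt_target (Φ x₀)).mem_nhds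
        (hFt _ hWm))).differentiableAt (by simp)
    have hdFd : DifferentiableAt ℝ (fderiv ℝ F) (φ x₀) :=
      (hdF.contDiffAt (hWo.mem_nhds hWm)).differentiableAt (by simp)
    refine fderiv_twoFormCLM_cyclic ?_ ?_
    · refine DifferentiableAt.congr_of_eventuallyEq ?_ hev
      exact DifferentiableAt.continuousAlternatingMapCompContinuousLinearMap
        (hΩd.comp (φ x₀) (hFx.differentiableAt (by simp))) hdFd
    · rw [hev.extDeriv_eq, extDeriv_pullback hΩd hFx (by
        simpa using WithTop.coe_le_coe.2 (le_top : (2 : ℕ∞) ≤ ⊤)), hΩ.closed _ _ (hFt _ hWm)]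
      rfl

end FormsInCharts

/-! ### The quotient Pf(σ - tτ)/Pf(τ) -/

section PencilQuotient

open Polynomial

variable {n : ℕ} {V : Type*} [AddCommGroup V] [Module ℝ V] [TopologicalSpace V]

/-- A two-form as a bilinear map. -/
def twoFormBilin (η : V [⋀^Fin 2]→L[ℝ] ℝ) : V →ₗ[ℝ] V →ₗ[ℝ] ℝ :=
  LinearMap.mk₂ ℝ (fun u w => η ![u, w]) (fun u u' w => η.vecCons_add ![w] u u')
    (fun c u w => η.vecCons_smul ![w] c u)
    (fun u w w' => by
      rw [twoForm_swap, twoForm_swap η u w, twoForm_swap η u w']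
      rw [show η ![w + w', u] = η ![w, u] + η ![w', u] from η.vecCons_add ![u] w w']
      ring)
    (fun c u w => by
      rw [twoForm_swap, twoForm_swap η u w]
      rw [show η ![c • w, u] = c • η ![w, u] from η.vecCons_smul ![u] c w, smul_neg])

@[simp]
theorem twoFormBilin_apply (η : V [⋀^Fin 2]→L[ℝ] ℝ) (u w : V) : twoFormBilin η u w = η ![u, w] :=
  rfl

theorem twoForm_self (η : V [⋀^Fin 2]→L[ℝ] ℝ) (u : V) : η ![u, u] = 0 := by
  have := twoForm_swap η u u
  linarith

/-- The matrix of a two-form in a family of vectors. -/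
def familyGram (m : Fin (2 * n) → V) (η : V [⋀^Fin 2]→L[ℝ] ℝ) :
    Matrix (Fin (2 * n)) (Fin (2 * n)) ℝ :=
  Matrix.of fun i j => η ![m i, m j]

theorem pfaffian_familyGram_eq_det_mul (b : Module.Basis (Fin (2 * n)) ℝ V)
    (m : Fin (2 * n) → V) (η : V [⋀^Fin 2]→L[ℝ] ℝ) :
    pfaffian (familyGram m η) = b.det m * pfaffian (familyGram b η) :=
  bilinPfaffian_eq_det_mul (twoFormBilin η) b m

theorem familyGram_sub_smul (m : Fin (2 * n) → V) (σ τ : V [⋀^Fin 2]→L[ℝ] ℝ) (t : ℝ) :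
    familyGram m (σ - t • τ) = familyGram m σ - t • familyGram m τ := by
  ext i j
  simp [familyGram]

theorem pfaffian_familyGram_ne_zero (b : Module.Basis (Fin (2 * n)) ℝ V)
    {τ : V [⋀^Fin 2]→L[ℝ] ℝ} (hτ : ∀ u, (∀ w, τ ![u, w] = 0) → u = 0) :
    pfaffian (familyGram b τ) ≠ 0 :=
  bilinPfaffian_ne_zero_of_nondegenerate (twoFormBilin τ) b (twoForm_self τ) hτ

/-- The polynomial `Pf(σ - t τ) / Pf(τ)` in `t`. -/
def pfaffianQuotient (m : Fin (2 * n) → V) (σ τ : V [⋀^Fin 2]→L[ℝ] ℝ) : ℝ[X] :=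
  C (pfaffian (familyGram m τ))⁻¹ * pfaffianPencil (familyGram m σ) (familyGram m τ)

theorem eval_pfaffianQuotient (m : Fin (2 * n) → V) (σ τ : V [⋀^Fin 2]→L[ℝ] ℝ) (t : ℝ) :
    (pfaffianQuotient m σ τ).eval t =
      (pfaffian (familyGram m τ))⁻¹ * pfaffian (familyGram m (σ - t • τ)) := by
  rw [pfaffianQuotient, eval_mul, eval_C, eval_pfaffianPencil, familyGram_sub_smul]

theorem natDegree_pfaffianQuotient {m : Fin (2 * n) → V} {σ τ : V [⋀^Fin 2]→L[ℝ] ℝ}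
    (hm : pfaffian (familyGram m τ) ≠ 0) : (pfaffianQuotient m σ τ).natDegree = n := by
  refine natDegree_eq_of_le_of_coeff_ne_zero
    ((natDegree_C_mul_le _ _).trans (natDegree_pfaffianPencil_le _ _)) ?_
  rw [pfaffianQuotient, coeff_C_mul, coeff_pfaffianPencil]
  exact mul_ne_zero (inv_ne_zero hm) (mul_ne_zero (pow_ne_zero _ (by norm_num)) hm)

theorem pfaffianQuotient_ne_zero {m : Fin (2 * n) → V} {σ τ : V [⋀^Fin 2]→L[ℝ] ℝ}
    (hm : pfaffian (familyGram m τ) ≠ 0) : pfaffianQuotient m σ τ ≠ 0 := by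
  intro h
  have : (pfaffianQuotient m σ τ).coeff n ≠ 0 := by
    rw [pfaffianQuotient, coeff_C_mul, coeff_pfaffianPencil]
    exact mul_ne_zero (inv_ne_zero hm) (mul_ne_zero (pow_ne_zero _ (by norm_num)) hm)
  exact this (by rw [h, coeff_zero])

theorem pfaffian_familyGram_sub_smul (b : Module.Basis (Fin (2 * n)) ℝ V)
    {σ τ : V [⋀^Fin 2]→L[ℝ] ℝ} (hb : pfaffian (familyGram b τ) ≠ 0) (m : Fin (2 * n) → V) (t : ℝ) :
    pfaffian (familyGram m (σ - t • τ)) =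
      pfaffian (familyGram m τ) * (pfaffianQuotient b σ τ).eval t := by
  rw [eval_pfaffianQuotient, pfaffian_familyGram_eq_det_mul b m,
    pfaffian_familyGram_eq_det_mul b m τ]
  field_simp

theorem pfaffianQuotient_eq (b : Module.Basis (Fin (2 * n)) ℝ V) {σ τ : V [⋀^Fin 2]→L[ℝ] ℝ}
    (hb : pfaffian (familyGram b τ) ≠ 0) {m : Fin (2 * n) → V}
    (hm : pfaffian (familyGram m τ) ≠ 0) : pfaffianQuotient b σ τ = pfaffianQuotient m σ τ := by
  refine Polynomial.funext fun t => ?_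
  rw [eval_pfaffianQuotient m, pfaffian_familyGram_sub_smul b hb m, inv_mul_cancel_left₀ hm]

/-- The vector v lies in the radical of σ - aτ, whose Pfaffian therefore vanishes. -/
theorem pfaffianQuotient_isRoot (b : Module.Basis (Fin (2 * n)) ℝ V) {σ τ : V [⋀^Fin 2]→L[ℝ] ℝ}
    {v : V} (hv : v ≠ 0) {a : ℝ} (ha : ∀ u, σ ![v, u] = a * τ ![v, u]) :
    (pfaffianQuotient b σ τ).IsRoot a := by
  rw [IsRoot.def, eval_pfaffianQuotient]
  refine mul_eq_zero_of_right _ (bilinPfaffian_eq_zero_of_degenerate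
    (twoFormBilin (σ - a • τ)) b hv (fun u => ?_) fun u => ?_)
  · simp [ha u]
  · rw [twoFormBilin_apply, twoForm_swap]
    simp [ha u]

end PencilQuotient

/-! ### Division by t - a -/

section LevelSetPolynomial

open Polynomial

variable {n : ℕ} {M : Type*} [TopologicalSpace M]
  [ChartedSpace (EuclideanSpace ℝ (Fin (2 * n))) M]

/-- The standard basis of the model space as a basis of a tangent space. -/
def tangentBasis (x : M) : Module.Basis (Fin (2 * n)) ℝ (TangentSpace (𝓡 (2 * n)) x) :=
  (EuclideanSpace.basisFun (Fin (2 * n)) ℝ).toBasis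

/-- The polynomial `Pf(σ - t τ) / (Pf(τ) (t - a))` at the points of a manifold. -/
def levelPolynomial (σ τ : TwoForm (2 * n) M) (a : M → ℝ) (x : M) : ℝ[X] :=
  pfaffianQuotient (tangentBasis x) (σ x) (τ x) /ₘ (X - C (a x))

variable {τ σ : TwoForm (2 * n) M} {a : M → ℝ}

theorem IsSymplecticForm.pfaffian_ne_zero (hτ : IsSymplecticForm τ) (x : M)
    (b : Module.Basis (Fin (2 * n)) ℝ (TangentSpace (𝓡 (2 * n)) x)) :
    pfaffian (familyGram b (τ x)) ≠ 0 :=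
  pfaffian_familyGram_ne_zero b (hτ.nondegenerate x)

theorem levelPolynomial_factorization {x : M} {v : TangentSpace (𝓡 (2 * n)) x} (hv : v ≠ 0)
    (ha : ∀ u, σ x ![v, u] = a x * τ x ![v, u]) :
    (X - C (a x)) * levelPolynomial σ τ a x =
      pfaffianQuotient (tangentBasis x) (σ x) (τ x) :=
  mul_divByMonic_eq_iff_isRoot.2 (pfaffianQuotient_isRoot _ hv ha)

theorem pfaffian_sub_smul_eq_levelPolynomial (hτ : IsSymplecticForm τ) {x : M}
    {v : TangentSpace (𝓡 (2 * n)) x} (hv : v ≠ 0)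
    (ha : ∀ u, σ x ![v, u] = a x * τ x ![v, u])
    (m : Fin (2 * n) → TangentSpace (𝓡 (2 * n)) x) (t : ℝ) :
    pfaffian (familyGram m (σ x - t • τ x)) =
      pfaffian (familyGram m (τ x)) * (t - a x) * (levelPolynomial σ τ a x).eval t := by
  rw [pfaffian_familyGram_sub_smul (tangentBasis x) (hτ.pfaffian_ne_zero x _),
    ← levelPolynomial_factorization hv ha]
  simp [mul_assoc]

theorem degree_levelPolynomial (hτ : IsSymplecticForm τ) {x : M}
    {v : TangentSpace (𝓡 (2 * n)) x} (hv : v ≠ 0)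
    (ha : ∀ u, σ x ![v, u] = a x * τ x ![v, u]) :
    (levelPolynomial σ τ a x).degree + 1 = n := by
  have h1 := congrArg degree (levelPolynomial_factorization hv ha)
  rw [degree_mul, degree_X_sub_C, degree_eq_natDegree
    (pfaffianQuotient_ne_zero (hτ.pfaffian_ne_zero x _)),
    natDegree_pfaffianQuotient (hτ.pfaffian_ne_zero x _)] at h1
  rw [add_comm]
  exact h1

/-- This crude bound holds at every point, on or off the level set, since it does not need a to be a
root. -/
theorem natDegree_levelPolynomial_le (hτ : IsSymplecticForm τ) (x : M) :
    (levelPolynomial σ τ a x).natDegree ≤ n := by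
  rw [levelPolynomial, natDegree_divByMonic _ (monic_X_sub_C _),
    natDegree_pfaffianQuotient (hτ.pfaffian_ne_zero _ _)]
  omega

end LevelSetPolynomial

/-! ### Smooth local extensions off the level set -/

section LevelSetIntegrals

open Polynomial

variable {n : ℕ} {M : Type*} [TopologicalSpace M]
  [ChartedSpace (EuclideanSpace ℝ (Fin (2 * n))) M] [IsManifold (𝓡 (2 * n)) ∞ M]

variable {τ σ : TwoForm (2 * n) M} {H : M → ℝ} {a : M → ℝ}
  {v : ∀ x : M, TangentSpace (𝓡 (2 * n)) x}

theorem IsHamiltonianField.ne_zero (hv : IsHamiltonianField τ H v) {x : M}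
    (hx : differential (d := 2 * n) H x ≠ 0) : v x ≠ 0 := by
  intro h0
  apply hx
  ext u
  have h1 := hv.eq x u
  have h2 : τ x ![v x, u] = 0 := by
    rw [h0]
    exact (τ x).map_coord_zero 0 rfl
  rw [h2] at h1
  simpa using h1.symm

theorem inChart_nondegenerate (hτ : IsSymplecticForm τ) {x₀ : M}
    {y : EuclideanSpace ℝ (Fin (2 * n))} (hy : y ∈ (extChartAt (𝓡 (2 * n)) x₀).target)
    (u : EuclideanSpace ℝ (Fin (2 * n))) (hu : ∀ w, τ.inChart x₀ y ![u, w] = 0) : u = 0 := by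
  have h1 : mfderiv (𝓡 (2 * n)) (𝓡 (2 * n)) (extChartAt (𝓡 (2 * n)) x₀).symm y u = 0 := by
    refine hτ.nondegenerate _ _ fun w => ?_
    have h2 := hu (chartVec x₀ _ w)
    rw [inChart_apply] at h2
    rw [mfderiv_extChartAt_symm_chartVec hy] at h2
    exact h2
  rw [← chartVec_mfderiv_extChartAt_symm hy u, h1, map_zero]

theorem inChart_fieldInChart (hv : IsHamiltonianField τ H v) (hH : ContMDiff (𝓡 (2 * n)) 𝓘(ℝ) ∞ H)
    {x₀ : M} {y : EuclideanSpace ℝ (Fin (2 * n))} (hy : y ∈ (extChartAt (𝓡 (2 * n)) x₀).target)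
    (u : EuclideanSpace ℝ (Fin (2 * n))) : τ.inChart x₀ y ![fieldInChart v x₀ y, u] =
      -fderiv ℝ (H ∘ (extChartAt (𝓡 (2 * n)) x₀).symm) y u := by
  rw [inChart_apply, mfderiv_fieldInChart v hy, hv.eq, fderiv_comp_extChartAt_symm hH hy]

theorem inChart_fieldInChart_of_contraction {x : M}
    (hσ : ∀ u, σ x ![v x, u] = -a x * differential (d := 2 * n) H x u)
    (hH : ContMDiff (𝓡 (2 * n)) 𝓘(ℝ) ∞ H)
    {x₀ : M} {y : EuclideanSpace ℝ (Fin (2 * n))} (hy : y ∈ (extChartAt (𝓡 (2 * n)) x₀).target)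
    (hx : (extChartAt (𝓡 (2 * n)) x₀).symm y = x)
    (u : EuclideanSpace ℝ (Fin (2 * n))) : σ.inChart x₀ y ![fieldInChart v x₀ y, u] =
      -a x * fderiv ℝ (H ∘ (extChartAt (𝓡 (2 * n)) x₀).symm) y u := by
  subst hx
  rw [inChart_apply, mfderiv_fieldInChart v hy, hσ, fderiv_comp_extChartAt_symm hH hy]

theorem fderiv_comp_extChartAt_symm_ne_zero (hH : ContMDiff (𝓡 (2 * n)) 𝓘(ℝ) ∞ H) {x₀ : M}
    (hx₀ : differential (d := 2 * n) H x₀ ≠ 0) :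
    fderiv ℝ (H ∘ (extChartAt (𝓡 (2 * n)) x₀).symm) (extChartAt (𝓡 (2 * n)) x₀ x₀) ≠ 0 := by
  have hx : ∀ z, z = x₀ → differential (d := 2 * n) H z ≠ 0 := by rintro _ rfl; exact hx₀
  have hx' := hx _ (extChartAt_to_inv (I := 𝓡 (2 * n)) x₀)
  intro h0
  apply hx'
  ext u
  have h1 := fderiv_comp_extChartAt_symm hH (mem_extChartAt_target (I := 𝓡 (2 * n)) x₀)
    (chartVec x₀ _ u)
  rw [mfderiv_extChartAt_symm_chartVec (mem_extChartAt_target (I := 𝓡 (2 * n)) x₀), h0] at h1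
  exact h1.symm

/-- Near a point of a regular level set, `a` has a smooth extension from the level set. -/
theorem exists_contDiffOn_factor {x₀ : M} (hσ : IsClosedFormAt σ x₀)
    (hH : ContMDiff (𝓡 (2 * n)) 𝓘(ℝ) ∞ H)
    (hv : ContMDiff (𝓡 (2 * n)) (𝓡 (2 * n)).tangent ∞
      (fun x => (⟨x, v x⟩ : TangentBundle (𝓡 (2 * n)) M)))
    (hx₀ : differential (d := 2 * n) H x₀ ≠ 0)
    (hσv : ∀ x, H x = H x₀ → ∀ u, σ x ![v x, u] = -a x * differential (d := 2 * n) H x u) :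
    ∃ (W : Set (EuclideanSpace ℝ (Fin (2 * n)))) (a' : EuclideanSpace ℝ (Fin (2 * n)) → ℝ),
      IsOpen W ∧ extChartAt (𝓡 (2 * n)) x₀ x₀ ∈ W ∧ W ⊆ (extChartAt (𝓡 (2 * n)) x₀).target ∧
      ContDiffOn ℝ ∞ (fun y => twoFormCLM _ (σ.inChart x₀ y)) W ∧ ContDiffOn ℝ ∞ a' W ∧
      ∀ y ∈ W, H ((extChartAt (𝓡 (2 * n)) x₀).symm y) = H x₀ →
        a' y = a ((extChartAt (𝓡 (2 * n)) x₀).symm y) := by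
  obtain ⟨W, hWo, hxW, hWt, hσW⟩ := hσ.smooth
  have hne := fderiv_comp_extChartAt_symm_ne_zero hH hx₀
  obtain ⟨w, hw⟩ : ∃ w, fderiv ℝ (H ∘ (extChartAt (𝓡 (2 * n)) x₀).symm)
      (extChartAt (𝓡 (2 * n)) x₀ x₀) w ≠ 0 := by
    by_contra! h0
    exact hne (ContinuousLinearMap.ext h0)
  have hdH : ContDiffOn ℝ ∞ (fderiv ℝ (H ∘ (extChartAt (𝓡 (2 * n)) x₀).symm)) W :=
    ((contDiffOn_comp_extChartAt_symm hH x₀).mono hWt).fderiv_of_isOpen hWo (by simp)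
  have hdHw : ContDiffOn ℝ ∞ (fun y => fderiv ℝ (H ∘ (extChartAt (𝓡 (2 * n)) x₀).symm) y w) W :=
    hdH.clm_apply contDiffOn_const
  -- Where dH(w) ≠ 0, the relation σ(v, w) = -a dH(w) can be solved for a, and the solution is
  -- smooth off the level set as well.
  set W' := W ∩ (fun y => fderiv ℝ (H ∘ (extChartAt (𝓡 (2 * n)) x₀).symm) y w) ⁻¹' {0}ᶜ with hW'
  refine ⟨W', fun y => -(twoFormCLM _ (σ.inChart x₀ y) (fieldInChart v x₀ y) w) /
    fderiv ℝ (H ∘ (extChartAt (𝓡 (2 * n)) x₀).symm) y w,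
    hdHw.continuousOn.isOpen_inter_preimage hWo isOpen_compl_singleton, ⟨hxW, hw⟩,
    inter_subset_left.trans hWt, hσW.mono inter_subset_left, ?_, ?_⟩
  · refine ContDiffOn.div (ContDiffOn.neg ?_) (hdHw.mono inter_subset_left) fun y hy => hy.2
    exact ((hσW.clm_apply ((contDiffOn_fieldInChart hv x₀).mono hWt)).clm_apply
      contDiffOn_const).mono inter_subset_left
  · intro y hy hyH
    have hy2 : fderiv ℝ (H ∘ (extChartAt (𝓡 (2 * n)) x₀).symm) y w ≠ 0 := hy.2
    beta_reduce
    rw [twoFormCLM_apply, inChart_fieldInChart_of_contraction (hσv _ hyH) hH (hWt hy.1) rfl]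
    field_simp

/-- The coefficients of the polynomial of a regular level set extend smoothly. -/
theorem exists_contDiffOn_coeff (hτ : IsSymplecticForm τ)
    {W : Set (EuclideanSpace ℝ (Fin (2 * n)))} {a' : EuclideanSpace ℝ (Fin (2 * n)) → ℝ} {x₀ : M}
    (hWt : W ⊆ (extChartAt (𝓡 (2 * n)) x₀).target)
    (hσW : ContDiffOn ℝ ∞ (fun y => twoFormCLM _ (σ.inChart x₀ y)) W)
    (ha' : ContDiffOn ℝ ∞ a' W) (k : ℕ) :
    ∃ g : EuclideanSpace ℝ (Fin (2 * n)) → ℝ, ContDiffOn ℝ ∞ g W ∧ ∀ y ∈ W,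
      a' y = a ((extChartAt (𝓡 (2 * n)) x₀).symm y) →
      g y = (levelPolynomial σ τ a ((extChartAt (𝓡 (2 * n)) x₀).symm y)).coeff k := by
  have hτW : ContDiffOn ℝ ∞ (fun y => twoFormCLM _ (τ.inChart x₀ y)) W :=
    (contDiffOn_twoFormCLM_comp (hτ.smooth x₀)).mono hWt
  let e := (EuclideanSpace.basisFun (Fin (2 * n)) ℝ).toBasis
  have hne : ∀ y ∈ W, pfaffian (familyGram e (τ.inChart x₀ y)) ≠ 0 := fun y hy =>
    pfaffian_familyGram_ne_zero e (inChart_nondegenerate hτ (hWt hy))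
  have hent : ∀ (η : TwoForm (2 * n) M),
      ContDiffOn ℝ ∞ (fun y => twoFormCLM _ (η.inChart x₀ y)) W → ∀ i j,
      ContDiffOn ℝ ∞ (fun y => familyGram e (η.inChart x₀ y) i j) W := by
    intro η hη i j
    refine ((hη.clm_apply (contDiffOn_const (c := e i))).clm_apply
      (contDiffOn_const (c := e j))).congr fun y _ => ?_
    rw [twoFormCLM_apply]
    rfl
  have hpf : ContDiffOn ℝ ∞ (fun y => pfaffian (familyGram e (τ.inChart x₀ y))) W := by
    unfold pfaffian
    exact contDiffOn_const.mul (ContDiffOn.sum fun s _ => contDiffOn_const.mul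
      (contDiffOn_prod fun i _ => hent τ hτW _ _))
  -- `tangentBasis` need not vary smoothly with the point; independence of the frame allows passing
  -- to the coordinate frame of the fixed chart.
  have hq : ∀ y ∈ W, pfaffianQuotient (tangentBasis ((extChartAt (𝓡 (2 * n)) x₀).symm y))
      (σ ((extChartAt (𝓡 (2 * n)) x₀).symm y)) (τ ((extChartAt (𝓡 (2 * n)) x₀).symm y)) =
      pfaffianQuotient e (σ.inChart x₀ y) (τ.inChart x₀ y) := by
    intro y hy
    have hg : ∀ η : TwoForm (2 * n) M, familyGram (fun i =>
        mfderiv (𝓡 (2 * n)) (𝓡 (2 * n)) (extChartAt (𝓡 (2 * n)) x₀).symm y (e i))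
        (η ((extChartAt (𝓡 (2 * n)) x₀).symm y)) = familyGram e (η.inChart x₀ y) := by
      intro η
      ext i j
      exact (inChart_apply η x₀ y (e i) (e j)).symm
    have h1 := pfaffianQuotient_eq (tangentBasis ((extChartAt (𝓡 (2 * n)) x₀).symm y))
      (σ := σ ((extChartAt (𝓡 (2 * n)) x₀).symm y)) (hτ.pfaffian_ne_zero _ _)
      (m := fun i => mfderiv (𝓡 (2 * n)) (𝓡 (2 * n)) (extChartAt (𝓡 (2 * n)) x₀).symm y (e i))
      (by rw [hg]; exact hne y hy)
    rw [h1]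
    unfold pfaffianQuotient
    rw [hg, hg]
  have hqk : ∀ i, ContDiffOn ℝ ∞
      (fun y => (pfaffianQuotient e (σ.inChart x₀ y) (τ.inChart x₀ y)).coeff i) W := by
    intro i
    simp only [pfaffianQuotient, coeff_C_mul]
    exact (hpf.inv hne).mul (contDiffOn_coeff_pfaffianPencil (hent σ hσW) (hent τ hτW) i)
  -- These are the coefficients of synthetic division by t - a, with a replaced by its smooth
  -- extension a'.
  refine ⟨fun y => ∑ i ∈ Finset.Icc (k + 1) n, a' y ^ (i - (k + 1)) *
    (pfaffianQuotient e (σ.inChart x₀ y) (τ.inChart x₀ y)).coeff i,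
    ContDiffOn.sum fun i _ => (ha'.pow _).mul (hqk i), fun y hy hay => ?_⟩
  beta_reduce
  rw [levelPolynomial, coeff_divByMonic_X_sub_C, hq y hy,
    natDegree_pfaffianQuotient (hne y hy), hay]

end LevelSetIntegrals

/-! ### Constancy along trajectories -/

section LevelSetConstancy

open Polynomial

variable {n : ℕ} {M : Type*} [TopologicalSpace M]
  [ChartedSpace (EuclideanSpace ℝ (Fin (2 * n))) M] [IsManifold (𝓡 (2 * n)) ∞ M]

variable {τ σ : TwoForm (2 * n) M} {H : M → ℝ} {h : ℝ} {a : M → ℝ}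
  {v : ∀ x : M, TangentSpace (𝓡 (2 * n)) x}

theorem IsHamiltonianField.contraction_eq (hv : IsHamiltonianField τ H v) {x : M}
    (hσv : ∀ u, σ x ![v x, u] = -a x * differential (d := 2 * n) H x u)
    (u : TangentSpace (𝓡 (2 * n)) x) : σ x ![v x, u] = a x * τ x ![v x, u] := by
  rw [hσv, hv.eq]
  ring

/-- The coefficients of the polynomial of a regular level set are smooth. -/
theorem exists_contMDiffOn_coeff_levelPolynomial (hτ : IsSymplecticForm τ)
    (hH : ContMDiff (𝓡 (2 * n)) 𝓘(ℝ) ∞ H) (hv : IsHamiltonianField τ H v)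
    (hh : IsRegularValue (2 * n) H h) (hσ : ∀ x, H x = h → IsClosedFormAt σ x)
    (hσv : ∀ x, H x = h → ∀ u, σ x ![v x, u] = -a x * differential (d := 2 * n) H x u)
    {x₀ : M} (hx₀ : H x₀ = h) :
    ∃ (U : Set M) (F : ℕ → M → ℝ), IsOpen U ∧ x₀ ∈ U ∧
      (∀ k, ContMDiffOn (𝓡 (2 * n)) 𝓘(ℝ) ∞ (F k) U) ∧
      ∀ x ∈ U, H x = h → ∀ k, F k x = (levelPolynomial σ τ a x).coeff k := by
  obtain ⟨W, a', hWo, hxW, hWt, hσW, ha', haa⟩ := exists_contDiffOn_factor (hσ x₀ hx₀) hH hv.smooth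
    (hh x₀ hx₀) (by rw [hx₀]; exact hσv)
  choose g hg hgeq using fun k => exists_contDiffOn_coeff (a := a) hτ hWt hσW ha' k
  have hU : IsOpen ((extChartAt (𝓡 (2 * n)) x₀).source ∩ extChartAt (𝓡 (2 * n)) x₀ ⁻¹' W) :=
    (continuousOn_extChartAt x₀).isOpen_inter_preimage (isOpen_extChartAt_source x₀) hWo
  refine ⟨_, fun k => g k ∘ extChartAt (𝓡 (2 * n)) x₀, hU,
    ⟨mem_extChartAt_source (I := 𝓡 (2 * n)) x₀, hxW⟩, fun k => ?_, fun x hx hxh k => ?_⟩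
  · exact (contMDiffOn_iff_contDiffOn.2 (hg k)).comp
      ((contMDiffOn_extChartAt (I := 𝓡 (2 * n)) (x := x₀)).mono
        (by rw [← extChartAt_source (𝓡 (2 * n))]; exact inter_subset_left)) fun y hy => hy.2
  · have hinv := (extChartAt (𝓡 (2 * n)) x₀).left_inv hx.1
    have h1 := hgeq k _ hx.2 (haa _ hx.2 (by rw [hinv, hxh, hx₀]))
    rw [hinv] at h1
    exact h1

/-- The coefficients of the polynomial have vanishing derivative along the flow. -/
theorem hasDerivAt_coeff_levelPolynomial (hτ : IsSymplecticForm τ)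
    (hH : ContMDiff (𝓡 (2 * n)) 𝓘(ℝ) ∞ H) (hv : IsHamiltonianField τ H v)
    (hh : IsRegularValue (2 * n) H h) (hσ : ∀ x, H x = h → IsClosedFormAt σ x)
    (hσv : ∀ x, H x = h → ∀ u, σ x ![v x, u] = -a x * differential (d := 2 * n) H x u)
    {γ : ℝ → M} {s₀ : ℝ}
    (hγ : HasMFDerivAt 𝓘(ℝ, ℝ) (𝓡 (2 * n)) γ s₀ ((1 : ℝ →L[ℝ] ℝ).smulRight (v (γ s₀))))
    (hγH : ∀ᶠ s in 𝓝 s₀, H (γ s) = h) (k : ℕ) :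
    HasDerivAt (fun s => (levelPolynomial σ τ a (γ s)).coeff k) 0 s₀ := by
  obtain ⟨x₀, hx₀⟩ : ∃ x₀, x₀ = γ s₀ := ⟨_, rfl⟩
  have hxh : H x₀ = h := hx₀ ▸ hγH.self_of_nhds
  obtain ⟨W, a', hWo, hxW, hWt, hσW, ha', haa⟩ := exists_contDiffOn_factor (hσ x₀ hxh) hH hv.smooth
    (hh x₀ hxh) (by rw [hxh]; exact hσv)
  choose g hg hgeq using fun k => exists_contDiffOn_coeff (a := a) hτ hWt hσW ha' k
  set φ := extChartAt (𝓡 (2 * n)) x₀ with hφ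
  have hsrc : ∀ᶠ s in 𝓝 s₀, γ s ∈ φ.source := by
    refine hγ.continuousAt.eventually ?_
    rw [← hx₀]
    exact extChartAt_source_mem_nhds (I := 𝓡 (2 * n)) x₀
  have hd : HasDerivAt (φ ∘ γ) (fieldInChart v x₀ ((φ ∘ γ) s₀)) s₀ :=
    hasDerivAt_extChartAt_comp_fieldInChart hγ hsrc.self_of_nhds
  have hpt : (φ ∘ γ) s₀ = φ x₀ := by rw [hx₀]; rfl
  have hWn : W ∈ 𝓝 ((φ ∘ γ) s₀) := by rw [hpt]; exact hWo.mem_nhds hxW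
  have hγW : ∀ᶠ s in 𝓝 s₀, (φ ∘ γ) s ∈ W := hd.continuousAt.eventually hWn
  have hinv : ∀ᶠ s in 𝓝 s₀, φ.symm ((φ ∘ γ) s) = γ s := hsrc.mono fun s hs => φ.left_inv hs
  have hcoef : ∀ᶠ s in 𝓝 s₀, ∀ k,
      (levelPolynomial σ τ a (γ s)).coeff k = (g k ∘ φ ∘ γ) s := by
    filter_upwards [hγW, hinv, hγH] with s h1 h2 h3 k
    have h4 := hgeq k _ h1 (haa _ h1 (by rw [h2, h3, hxh]))
    rw [h2] at h4
    exact h4.symm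
  -- D k is the derivative of the k-th coefficient along the curve. Then ∑ D k t^k is the derivative
  -- of the value at t, zero for all t ≠ a, so this polynomial is zero.
  set D : ℕ → ℝ := fun k => fderiv ℝ (g k) ((φ ∘ γ) s₀) (fieldInChart v x₀ ((φ ∘ γ) s₀)) with hD
  have hDk : ∀ k, HasDerivAt (fun s => (levelPolynomial σ τ a (γ s)).coeff k) (D k) s₀ := by
    intro k
    have h1 : DifferentiableAt ℝ (g k) ((φ ∘ γ) s₀) :=
      ((hg k).contDiffAt hWn).differentiableAt (by simp)
    exact (h1.hasFDerivAt.comp_hasDerivAt s₀ hd).congr_of_eventuallyEq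
      (hcoef.mono fun s hs => hs k)
  -- The range n + k + 1 exceeds the degree uniformly in s and also contains the given k, which is
  -- read off at the end.
  have hdeg : ∀ s, (levelPolynomial σ τ a (γ s)).natDegree < n + k + 1 := fun s => by
    have := natDegree_levelPolynomial_le (σ := σ) (a := a) hτ (γ s)
    omega
  have hp : ∀ t, HasDerivAt (fun s => (levelPolynomial σ τ a (γ s)).eval t)
      (∑ k ∈ Finset.range (n + k + 1), D k * t ^ k) s₀ := by
    intro t
    refine (HasDerivAt.fun_sum fun k _ => (hDk k).mul_const (t ^ k)).congr_of_eventuallyEq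
      (Filter.Eventually.of_forall fun s => ?_)
    exact eval_eq_sum_range' (hdeg s) t
  have hτW : ContDiffOn ℝ ∞ (fun y => twoFormCLM _ (τ.inChart x₀ y)) W :=
    (contDiffOn_twoFormCLM_comp (hτ.smooth x₀)).mono hWt
  have hone : (1 : WithTop ℕ∞) ≤ ∞ := by exact_mod_cast le_top
  have hHs : ContDiffAt ℝ ∞ (H ∘ φ.symm) ((φ ∘ γ) s₀) :=
    ((contDiffOn_comp_extChartAt_symm hH x₀).mono hWt).contDiffAt hWn
  have hzero : ∀ t, t ≠ a' ((φ ∘ γ) s₀) → ∑ k ∈ Finset.range (n + k + 1), D k * t ^ k = 0 := by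
    intro t ht
    refine deriv_eq_zero_of_pfaffian_factorization (γ := φ ∘ γ) (s₀ := s₀)
      (EuclideanSpace.basisFun (Fin (2 * n)) ℝ).toBasis (V := fieldInChart v x₀)
      (τ := fun y => twoFormCLM _ (τ.inChart x₀ y)) (σ := fun y => twoFormCLM _ (σ.inChart x₀ y))
      (a := a') (H := H ∘ φ.symm) ((hτW.contDiffAt hWn).of_le hone)
      ((hσW.contDiffAt hWn).of_le hone) ?_ ?_ ?_ ?_
      ((((contDiffOn_fieldInChart hv.smooth x₀).mono hWt).contDiffAt hWn).of_le hone)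
      (hHs.of_le (by simpa using WithTop.coe_le_coe.2 (le_top : (2 : ℕ∞) ≤ ⊤))) ?_
      ((ha'.contDiffAt hWn).of_le hone) ?_ ?_ hd ?_ ?_ (hp t) ht ?_
    · exact Filter.Eventually.of_forall fun z u w => by
        rw [twoFormCLM_apply, twoFormCLM_apply, twoForm_swap]
    · exact Filter.Eventually.of_forall fun z u w => by
        rw [twoFormCLM_apply, twoFormCLM_apply, twoForm_swap]
    · rw [hpt]; exact (hτ.isClosedFormAt x₀).cyclic
    · rw [hpt]; exact (hσ x₀ hxh).cyclic
    · rw [hpt]; exact fderiv_comp_extChartAt_symm_ne_zero hH (hh x₀ hxh)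
    · filter_upwards [hWn] with z hz u
      rw [twoFormCLM_apply]
      exact inChart_fieldInChart hv hH (hWt hz) u
    · filter_upwards [hWn] with z hz hzH u
      have hzh : H (φ.symm z) = h := by
        rw [← hγH.self_of_nhds, ← hinv.self_of_nhds]; exact hzH
      rw [twoFormCLM_apply, haa z hz (hzh.trans hxh.symm)]
      exact inChart_fieldInChart_of_contraction (hσv _ hzh) hH (hWt hz) rfl u
    · filter_upwards [hinv, hγH] with s h1 h2
      simp only [Function.comp_apply] at h1 ⊢
      rw [h1, h2]
      have := hinv.self_of_nhds
      simp only [Function.comp_apply] at this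
      rw [this, hγH.self_of_nhds]
    · intro u hu
      refine inChart_nondegenerate hτ (hWt (mem_of_mem_nhds hWn)) u fun w => ?_
      rw [← twoFormCLM_apply]
      exact hu w
    · filter_upwards [hγW, hinv, hγH] with s h1 h2 h3 m
      have h4 : H (φ.symm ((φ ∘ γ) s)) = h := by rw [h2, h3]
      have h5 := pfaffian_sub_smul_eq_levelPolynomial hτ (hv.ne_zero (hh _ h4))
        (hv.contraction_eq (hσv _ h4))
        (fun i => mfderiv (𝓡 (2 * n)) (𝓡 (2 * n)) φ.symm ((φ ∘ γ) s) (m i)) t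
      rw [haa _ h1 (h4.trans hxh.symm)]
      have h6 : ∀ η : TwoForm (2 * n) M, ∀ i j, twoFormCLM _ (η.inChart x₀ ((φ ∘ γ) s)) (m i) (m j)
          = familyGram (fun i => mfderiv (𝓡 (2 * n)) (𝓡 (2 * n)) φ.symm ((φ ∘ γ) s) (m i))
            (η (φ.symm ((φ ∘ γ) s))) i j := by
        intro η i j
        rw [twoFormCLM_apply]
        exact inChart_apply η x₀ _ _ _
      rw [familyGram_sub_smul] at h5
      convert h5 using 2
      · ext i j
        exact congrArg₂ (fun p q : ℝ => p - t * q) (h6 σ i j) (h6 τ i j)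
      · congr 2
        ext i j
        exact h6 τ i j
      · rw [h2]
  have hq : (∑ k ∈ Finset.range (n + k + 1), C (D k) * X ^ k : ℝ[X]) = 0 := by
    refine eq_zero_of_infinite_isRoot _
      ((Set.finite_singleton (a' ((φ ∘ γ) s₀))).infinite_compl.mono
      fun t ht => ?_)
    have := hzero t ht
    simpa [IsRoot, eval_finsetSum] using this
  have hDz : D k = 0 := by
    have h1 := congrArg (fun p => coeff p k) hq
    simp only [finsetSum_coeff, coeff_C_mul, coeff_X_pow, coeff_zero] at h1
    simpa using h1
  rw [← hDz]
  exact hDk k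

/-- Energy is conserved because dH(v) = -τ(v, v) = 0; hence a trajectory starting on the level set
stays there. -/
theorem IsHamiltonianField.eq_of_isMIntegralCurveOn (hH : ContMDiff (𝓡 (2 * n)) 𝓘(ℝ) ∞ H)
    (hv : IsHamiltonianField τ H v) {γ : ℝ → M} {α β : ℝ}
    (hγ : IsMIntegralCurveOn (I := 𝓡 (2 * n)) γ v (Ioo α β)) {s t : ℝ} (hs : s ∈ Ioo α β)
    (ht : t ∈ Ioo α β) : H (γ s) = H (γ t) := by
  have hd : ∀ s ∈ Ioo α β, HasDerivAt (H ∘ γ) 0 s := by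
    intro s hs
    have h1 := HasMFDerivAt.comp s
      ((hH (γ s)).mdifferentiableAt (by simp)).hasMFDerivAt
      ((hγ s hs).hasMFDerivAt (Ioo_mem_nhds hs.1 hs.2))
    have h2 : HasMFDerivAt 𝓘(ℝ, ℝ) 𝓘(ℝ) (H ∘ γ) s
        (ContinuousLinearMap.toSpanSingleton ℝ (0 : ℝ)) := by
      refine h1.congr_mfderiv (ContinuousLinearMap.ext fun r => ?_)
      have h3 := hv.eq (γ s) (v (γ s))
      rw [twoForm_self] at h3
      have h4 : differential (d := 2 * n) H (γ s) (v (γ s)) = 0 := by linarith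
      have h5 := ContinuousLinearMap.map_smul (differential (d := 2 * n) H (γ s)) r (v (γ s))
      rw [h4] at h5
      exact h5
    exact hasMFDerivAt_iff_hasFDerivAt.1 h2
  exact isOpen_Ioo.is_const_of_deriv_eq_zero isPreconnected_Ioo
    (fun s hs => (hd s hs).differentiableAt.differentiableWithinAt) (fun s hs => (hd s hs).deriv)
    hs ht

/-- The polynomial of a regular level set is constant along trajectories. -/
theorem levelPolynomial_eq_of_mem_trajectory (hτ : IsSymplecticForm τ)
    (hH : ContMDiff (𝓡 (2 * n)) 𝓘(ℝ) ∞ H) (hv : IsHamiltonianField τ H v)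
    (hh : IsRegularValue (2 * n) H h) (hσ : ∀ x, H x = h → IsClosedFormAt σ x)
    (hσv : ∀ x, H x = h → ∀ u, σ x ![v x, u] = -a x * differential (d := 2 * n) H x u)
    {x y : M} (hx : H x = h) (hy : y ∈ trajectory v x) :
    levelPolynomial σ τ a y = levelPolynomial σ τ a x := by
  obtain ⟨γ, α, β, s, hα, hβ, hs, hγ, rfl, rfl⟩ := hy
  have hγh : ∀ s ∈ Ioo α β, H (γ s) = h := fun s hs =>
    (hv.eq_of_isMIntegralCurveOn hH hγ hs ⟨hα, hβ⟩).trans hx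
  ext k
  have hd : ∀ s ∈ Ioo α β, HasDerivAt (fun s => (levelPolynomial σ τ a (γ s)).coeff k) 0 s := by
    intro s hs
    refine hasDerivAt_coeff_levelPolynomial hτ hH hv hh hσ hσv
      ((hγ s hs).hasMFDerivAt (Ioo_mem_nhds hs.1 hs.2)) ?_ k
    filter_upwards [Ioo_mem_nhds hs.1 hs.2] with r hr using hγh r hr
  exact isOpen_Ioo.is_const_of_deriv_eq_zero isPreconnected_Ioo
    (fun s hs => (hd s hs).differentiableAt.differentiableWithinAt) (fun s hs => (hd s hs).deriv)
    hs ⟨hα, hβ⟩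

theorem isIntegralOn_coeff_levelPolynomial (hτ : IsSymplecticForm τ)
    (hH : ContMDiff (𝓡 (2 * n)) 𝓘(ℝ) ∞ H) (hv : IsHamiltonianField τ H v)
    (hh : IsRegularValue (2 * n) H h) (hσ : ∀ x, H x = h → IsClosedFormAt σ x)
    (hσv : ∀ x, H x = h → ∀ u, σ x ![v x, u] = -a x * differential (d := 2 * n) H x u) (k : ℕ) :
    IsIntegralOn v (levelSet H h) fun x => (levelPolynomial σ τ a x.1).coeff k where
  smooth x := by
    obtain ⟨U, F, hU, hxU, hF, hFeq⟩ := exists_contMDiffOn_coeff_levelPolynomial hτ hH hv hh hσ hσv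
      x.2
    exact ⟨U, F k, hU, hxU, hF k, fun y hy => hFeq y.1 hy y.2 k⟩
  const x y hy := by
    rw [levelPolynomial_eq_of_mem_trajectory hτ hH hv hh hσ hσv x.2 hy]

theorem isIntegralOn_eval_levelPolynomial (hτ : IsSymplecticForm τ)
    (hH : ContMDiff (𝓡 (2 * n)) 𝓘(ℝ) ∞ H) (hv : IsHamiltonianField τ H v)
    (hh : IsRegularValue (2 * n) H h) (hσ : ∀ x, H x = h → IsClosedFormAt σ x)
    (hσv : ∀ x, H x = h → ∀ u, σ x ![v x, u] = -a x * differential (d := 2 * n) H x u) (t : ℝ) :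
    IsIntegralOn v (levelSet H h) fun x => (levelPolynomial σ τ a x.1).eval t where
  smooth x := by
    obtain ⟨U, F, hU, hxU, hF, hFeq⟩ := exists_contMDiffOn_coeff_levelPolynomial hτ hH hv hh hσ hσv
      x.2
    refine ⟨U, fun y => ∑ k ∈ Finset.range (n + 1), F k y * t ^ k, hU, hxU,
      contMDiffOn_finsetSum fun k _ => (hF k).mul contMDiffOn_const, fun y hy => ?_⟩
    have hdeg : (levelPolynomial σ τ a y.1).natDegree < n + 1 :=
      Nat.lt_succ_of_le (natDegree_levelPolynomial_le hτ y.1)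
    beta_reduce
    rw [eval_eq_sum_range' hdeg]
    exact Finset.sum_congr rfl fun k _ => by rw [hFeq y.1 hy y.2 k]
  const x y hy := by
    rw [levelPolynomial_eq_of_mem_trajectory hτ hH hv hh hσ hσv x.2 hy]

end LevelSetConstancy

/-! ### Existence of the factors a₁ and a₂ -/

section Proportionality

variable {d : ℕ} {M : Type*} [TopologicalSpace M] [ChartedSpace (EuclideanSpace ℝ (Fin d)) M]

theorem differential_eq_fderiv {K : M → ℝ} {x : M} (hK : ContMDiffAt (𝓡 d) 𝓘(ℝ) ∞ K x)
    (u : TangentSpace (𝓡 d) x) : differential K x u =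
      fderiv ℝ (K ∘ (extChartAt (𝓡 d) x).symm) (extChartAt (𝓡 d) x x) u := by
  have h1 := (hK.mdifferentiableAt (by simp)).mfderiv
  rw [ModelWithCorners.range_eq_univ, fderivWithin_univ] at h1
  exact congrArg (fun l => l u) h1

theorem contDiffAt_comp_extChartAt_symm {K : M → ℝ} {x : M}
    (hK : ContMDiffAt (𝓡 d) 𝓘(ℝ) ∞ K x) :
    ContDiffAt ℝ ∞ (K ∘ (extChartAt (𝓡 d) x).symm) (extChartAt (𝓡 d) x x) := by
  have h1 := (contMDiffAt_iff.1 hK).2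
  rw [ModelWithCorners.range_eq_univ, contDiffWithinAt_univ] at h1
  exact h1

/-- The differential of a function that is constant on a level set of `H` is proportional to that
of `H`. -/
theorem exists_differential_eq_mul {H K : M → ℝ} {x : M} (hH : ContMDiffAt (𝓡 d) 𝓘(ℝ) ∞ H x)
    (hx : differential (d := d) H x ≠ 0) (hK : ContMDiffAt (𝓡 d) 𝓘(ℝ) ∞ K x)
    (hHK : ∀ z, H z = H x → K z = K x) :
    ∃ a : ℝ, ∀ u : TangentSpace (𝓡 d) x, differential K x u = a * differential H x u := by
  have hHs := (contDiffAt_comp_extChartAt_symm hH).hasStrictFDerivAt (by simp)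
  have hKs := (contDiffAt_comp_extChartAt_symm hK).hasStrictFDerivAt (by simp)
  have hne : fderiv ℝ (H ∘ (extChartAt (𝓡 d) x).symm) (extChartAt (𝓡 d) x x) ≠ 0 := by
    intro h0
    apply hx
    ext u
    rw [differential_eq_fderiv hH u, h0]
    rfl
  obtain ⟨a, ha⟩ := apply_eq_zero_of_eventually_level hHs hne (hKs.sub_const (K x))
    (Filter.Eventually.of_forall fun z hz => by
      simp only [Function.comp_apply, extChartAt_to_inv] at hz ⊢
      rw [hHK _ hz, sub_self])
  refine ⟨a, fun u => ?_⟩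
  rw [differential_eq_fderiv hH u, differential_eq_fderiv hK u, ha]
  rfl

variable [IsManifold (𝓡 d) ∞ M] {N : Type*} [TopologicalSpace N]
  [ChartedSpace (EuclideanSpace ℝ (Fin d)) N] [IsManifold (𝓡 d) ∞ N]

/-- A smooth map taking the trajectory of `v` through `x` into that of `w` takes `v` at `x` to a
multiple of `w`. -/
theorem exists_mfderiv_eq_smul [T2Space N] {v : ∀ x : M, TangentSpace (𝓡 d) x}
    {w : ∀ y : N, TangentSpace (𝓡 d) y}
    (hv : ContMDiff (𝓡 d) (𝓡 d).tangent ∞ (fun x => (⟨x, v x⟩ : TangentBundle (𝓡 d) M)))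
    (hw : ContMDiff (𝓡 d) (𝓡 d).tangent ∞ (fun y => (⟨y, w y⟩ : TangentBundle (𝓡 d) N)))
    {Φ : M → N} {x : M} (hΦ : ∀ᶠ z in 𝓝 x, ContMDiffAt (𝓡 d) (𝓡 d) ∞ Φ z)
    (htr : Φ '' trajectory v x ⊆ trajectory w (Φ x)) (hne : w (Φ x) ≠ 0) :
    ∃ a : ℝ, mfderiv (𝓡 d) (𝓡 d) Φ x (v x) = a • w (Φ x) := by
  have : IsManifold (𝓡 d) 1 M := IsManifold.of_le (n := ∞) (by exact_mod_cast le_top)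
  obtain ⟨γ, rfl, hγ⟩ := exists_isMIntegralCurveAt_of_contMDiffAt_boundaryless (I := 𝓡 d) 0
    ((hv x).of_le (by exact_mod_cast le_top))
  obtain ⟨ε, hε, hγε⟩ := isMIntegralCurveAt_iff'.1 hγ
  rw [Real.ball_eq_Ioo, zero_sub, zero_add] at hγε
  have hball : Ioo (-ε) ε ∈ 𝓝 (0 : ℝ) := Ioo_mem_nhds (neg_lt_zero.2 hε) hε
  have hγd : ∀ t ∈ Ioo (-ε) ε,
      HasMFDerivAt 𝓘(ℝ, ℝ) (𝓡 d) γ t ((1 : ℝ →L[ℝ] ℝ).smulRight (v (γ t))) := fun t ht =>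
    (hγε t ht).hasMFDerivAt (Ioo_mem_nhds ht.1 ht.2)
  have hγc : ContinuousAt γ 0 := (hγd 0 (mem_of_mem_nhds hball)).continuousAt
  set φ := extChartAt (𝓡 d) (γ 0) with hφ
  set φ' := extChartAt (𝓡 d) (Φ (γ 0)) with hφ'
  have hcc : ContinuousAt (Φ ∘ γ) 0 := ContinuousAt.comp hΦ.self_of_nhds.continuousAt hγc
  have hsrc : ∀ᶠ t in 𝓝 0, γ t ∈ φ.source :=
    hγc.eventually (extChartAt_source_mem_nhds (I := 𝓡 d) (γ 0))
  have hsrc' : ∀ᶠ t in 𝓝 0, (Φ ∘ γ) t ∈ φ'.source :=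
    hcc.eventually (extChartAt_source_mem_nhds (I := 𝓡 d) (Φ (γ 0)))
  have hcd : ∀ᶠ t in 𝓝 0, HasDerivAt (φ' ∘ Φ ∘ γ)
      (chartVec (Φ (γ 0)) (Φ (γ t)) (mfderiv (𝓡 d) (𝓡 d) Φ (γ t) (v (γ t)))) t := by
    filter_upwards [hball, hsrc', hγc.eventually hΦ] with t ht h2 h3
    refine hasDerivAt_extChartAt_comp (γ := Φ ∘ γ) ?_ h2
    refine (HasMFDerivAt.comp t (h3.mdifferentiableAt (by simp)).hasMFDerivAt
      (hγd t ht)).congr_mfderiv (ContinuousLinearMap.ext fun r => ?_)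
    exact ContinuousLinearMap.map_smul (mfderiv (𝓡 d) (𝓡 d) Φ (γ t)) r (v (γ t))
  have hF : ContDiffAt ℝ ∞ (φ' ∘ Φ ∘ φ.symm) (φ (γ 0)) := by
    have h1 := (contMDiffAt_iff.1 hΦ.self_of_nhds).2
    rw [ModelWithCorners.range_eq_univ, contDiffWithinAt_univ] at h1
    exact h1
  have hφγ : ∀ᶠ t in 𝓝 0, HasDerivAt (φ ∘ γ) (fieldInChart v (γ 0) ((φ ∘ γ) t)) t := by
    filter_upwards [hball, hsrc] with t ht h2
    exact hasDerivAt_extChartAt_comp_fieldInChart (hγd t ht) h2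
  have hφc : ContinuousAt (φ ∘ γ) 0 := hφγ.self_of_nhds.continuousAt
  have heq : ∀ᶠ t in 𝓝 0, (φ' ∘ Φ ∘ γ) t = ((φ' ∘ Φ ∘ φ.symm) ∘ φ ∘ γ) t := by
    filter_upwards [hsrc] with t ht
    simp only [Function.comp_apply, φ.left_inv ht]
  -- The velocity of the image curve is computed twice: this form is visibly continuous in t, while
  -- `hcd` identifies it with dΦ(v). Uniqueness of the derivative at 0 joins them.
  have hcw : ∀ᶠ t in 𝓝 0, HasDerivAt (φ' ∘ Φ ∘ γ)
      (fderiv ℝ (φ' ∘ Φ ∘ φ.symm) ((φ ∘ γ) t) (fieldInChart v (γ 0) ((φ ∘ γ) t))) t := by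
    have hFd : ∀ᶠ t in 𝓝 0, DifferentiableAt ℝ (φ' ∘ Φ ∘ φ.symm) ((φ ∘ γ) t) :=
      hφc.eventually (((hF.of_le (by exact_mod_cast le_top : (1 : WithTop ℕ∞) ≤ ∞)).eventually
        (by simp)).mono fun z hz => hz.differentiableAt one_ne_zero)
    filter_upwards [heq.eventually_nhds, hFd, hφγ] with t h1 h2 h3
    exact (h2.hasFDerivAt.comp_hasDerivAt t h3).congr_of_eventuallyEq h1
  have hwc : ContinuousAt (fun t => fderiv ℝ (φ' ∘ Φ ∘ φ.symm) ((φ ∘ γ) t)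
      (fieldInChart v (γ 0) ((φ ∘ γ) t))) 0 := by
    have h1 : ContinuousAt (fderiv ℝ (φ' ∘ Φ ∘ φ.symm)) ((φ ∘ γ) 0) :=
      (hF.fderiv_right (m := 0) (by simp)).continuousAt
    have h2 : ContinuousAt (fieldInChart v (γ 0)) ((φ ∘ γ) 0) :=
      (contDiffOn_fieldInChart hv (γ 0)).continuousOn.continuousAt
        ((isOpen_extChartAt_target (γ 0)).mem_nhds (mem_extChartAt_target (γ 0)))
    exact (ContinuousAt.comp (f := φ ∘ γ) h1 hφc).clm_apply (ContinuousAt.comp (f := φ ∘ γ) h2 hφc)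
  obtain ⟨a, ha⟩ := exists_smul_eq_of_eventually_mem_trajectory hw (c := Φ ∘ γ) hcc hcw hwc
    (by
      filter_upwards [hball] with t ht
      exact htr ⟨γ t, ⟨γ, -ε, ε, t, neg_lt_zero.2 hε, hε, ht, hγε, rfl, rfl⟩, rfl⟩)
    (chartVec_ne_zero (mem_extChartAt_source (I := 𝓡 d) (Φ (γ 0))) hne)
  rw [hcw.self_of_nhds.unique hcd.self_of_nhds] at ha
  refine ⟨a, ?_⟩
  by_contra hcon
  refine chartVec_ne_zero (mem_extChartAt_source (I := 𝓡 d) (Φ (γ 0))) (sub_ne_zero.2 hcon) ?_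
  rw [map_sub, map_smul, sub_eq_zero]
  exact ha

end Proportionality

end

/-! ### The main theorem -/

/-- The quotient is stated multiplied out, which covers t = a; with Pf(Ω) ≠ 0 the identity at t ≠ a
determines P. Writing `degree + 1 = n` avoids truncated subtraction and excludes P = 0. -/
theorem theorem2 {n : ℕ} {M M' : Type*}
    [TopologicalSpace M] [T2Space M]
    [ChartedSpace (EuclideanSpace ℝ (Fin (2 * n))) M] [IsManifold (𝓡 (2 * n)) ∞ M]
    [TopologicalSpace M'] [T2Space M']
    [ChartedSpace (EuclideanSpace ℝ (Fin (2 * n))) M'] [IsManifold (𝓡 (2 * n)) ∞ M']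
    (Ω : TwoForm (2 * n) M) (hΩ : IsSymplecticForm Ω)
    (Ω' : TwoForm (2 * n) M') (hΩ' : IsSymplecticForm Ω')
    (H : M → ℝ) (hH : ContMDiff (𝓡 (2 * n)) 𝓘(ℝ) ∞ H)
    (H' : M' → ℝ) (hH' : ContMDiff (𝓡 (2 * n)) 𝓘(ℝ) ∞ H')
    (v : ∀ x : M, TangentSpace (𝓡 (2 * n)) x) (hv : IsHamiltonianField Ω H v)
    (v' : ∀ y : M', TangentSpace (𝓡 (2 * n)) y) (hv' : IsHamiltonianField Ω' H' v')
    (h h' : ℝ) (hh : IsRegularValue (2 * n) H h) (hh' : IsRegularValue (2 * n) H' h')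
    (Φ : PartialDiffeomorph (𝓡 (2 * n)) (𝓡 (2 * n)) M M' ∞)
    (hsource : levelSet H h ⊆ Φ.source)
    (himage : Φ '' levelSet H h = levelSet H' h')
    (htraj : IsTrajectorialOn Φ v v' (levelSet H h)) :
    -- the coefficients of proportionality, determined by `Φ_* v = a₁ v'` and `Φ^* dH' = a₂ dH` on
    -- the level set
    ∃ a₁ a₂ : levelSet H h → ℝ,
      (∀ x : levelSet H h,
        mfderiv (𝓡 (2 * n)) (𝓡 (2 * n)) Φ x.1 (v x.1) = a₁ x • v' (Φ x.1)) ∧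
      (∀ (x : levelSet H h) (u : TangentSpace (𝓡 (2 * n)) x.1),
        differential (d := 2 * n) H' (Φ x.1) (mfderiv (𝓡 (2 * n)) (𝓡 (2 * n)) Φ x.1 u) =
          a₂ x * differential (d := 2 * n) H x.1 u) ∧
      -- the quotient of the Pfaffians is a polynomial of degree `n - 1` in `t`, independent of the
      -- basis of the tangent space
      ∃ P : levelSet H h → Polynomial ℝ,
        (∀ x : levelSet H h, (P x).degree + 1 = n) ∧
        (∀ (x : levelSet H h)
            (b : Module.Basis (Fin (2 * n)) ℝ (TangentSpace (𝓡 (2 * n)) x.1)),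
          pfaffian (gramMatrix b (Ω x.1)) ≠ 0 ∧
          ∀ t : ℝ, pfaffian (gramMatrix b (TwoForm.pullback Φ Ω' x.1 - t • Ω x.1)) =
            pfaffian (gramMatrix b (Ω x.1)) * (t - a₁ x * a₂ x) * (P x).eval t) ∧
        -- its values and its coefficients are integrals
        (∀ t : ℝ, IsIntegralOn v (levelSet H h) fun x => (P x).eval t) ∧
        (∀ k : ℕ, IsIntegralOn v (levelSet H h) fun x => (P x).coeff k) := by
  classical
  have hΦ : ∀ x ∈ Φ.source, ContMDiffAt (𝓡 (2 * n)) (𝓡 (2 * n)) ∞ Φ x := fun x hx =>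
    Φ.contMDiffOn_toFun.contMDiffAt (Φ.open_source.mem_nhds hx)
  have hlevel : ∀ x ∈ levelSet H h, H' (Φ x) = h' := fun x hx =>
    himage.subset (mem_image_of_mem Φ hx)
  have ha₁ : ∀ x : levelSet H h, ∃ a : ℝ,
      mfderiv (𝓡 (2 * n)) (𝓡 (2 * n)) Φ x.1 (v x.1) = a • v' (Φ x.1) := fun x =>
    exists_mfderiv_eq_smul hv.smooth hv'.smooth
      (Filter.eventually_of_mem (Φ.open_source.mem_nhds (hsource x.2)) hΦ)
      (htraj x.1 x.2).subset (hv'.ne_zero (hh' _ (hlevel x.1 x.2)))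
  have ha₂ : ∀ x : levelSet H h, ∃ a : ℝ, ∀ u : TangentSpace (𝓡 (2 * n)) x.1,
      differential (d := 2 * n) H' (Φ x.1) (mfderiv (𝓡 (2 * n)) (𝓡 (2 * n)) Φ x.1 u) =
        a * differential (d := 2 * n) H x.1 u := by
    intro x
    have hx := hΦ x.1 (hsource x.2)
    obtain ⟨a, ha⟩ := exists_differential_eq_mul (K := H' ∘ Φ) hH.contMDiffAt (hh x.1 x.2)
      (hH'.contMDiffAt.comp x.1 hx) fun z hz =>
        (hlevel z (hz.trans x.2)).trans (hlevel x.1 x.2).symm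
    exact ⟨a, fun u => (congrArg (fun l => l u) (mfderiv_comp x.1
      (hH'.contMDiffAt.mdifferentiableAt (by simp))
      (hx.mdifferentiableAt (by simp))).symm).trans (ha u)⟩
  choose a₁ ha₁ using ha₁
  choose a₂ ha₂ using ha₂
  -- The value 0 off the level set is arbitrary: the relations imposed on a concern points of the
  -- level set only.
  let a : M → ℝ := fun x => if hx : x ∈ levelSet H h then a₁ ⟨x, hx⟩ * a₂ ⟨x, hx⟩ else 0
  have ha : ∀ x : levelSet H h, a x.1 = a₁ x * a₂ x := fun x => dif_pos x.2
  -- Ω'(Φ_*v, Φ_*u) = a₁ Ω'(v', Φ_*u) = -a₁ dH'(Φ_*u) = -a₁ a₂ dH(u).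
  have hcon : ∀ x, H x = h → ∀ u, TwoForm.pullback Φ Ω' x ![v x, u] =
      -a x * differential (d := 2 * n) H x u := by
    intro x hx u
    have e1 : TwoForm.pullback Φ Ω' x ![v x, u] = Ω' (Φ x)
        ![mfderiv (𝓡 (2 * n)) (𝓡 (2 * n)) Φ x (v x), mfderiv (𝓡 (2 * n)) (𝓡 (2 * n)) Φ x u] := by
      refine congrArg (Ω' (Φ x)) (funext fun i => ?_)
      fin_cases i <;> rfl
    have e2 : ∀ (r : ℝ) (y z : TangentSpace (𝓡 (2 * n)) (Φ x)),
        Ω' (Φ x) ![r • y, z] = r * Ω' (Φ x) ![y, z] := fun r y z =>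
      congrArg (fun l => l z) ((twoFormBilin (Ω' (Φ x))).map_smul r y)
    rw [e1, ha₁ ⟨x, hx⟩, e2, hv'.eq, ha₂ ⟨x, hx⟩, ha ⟨x, hx⟩]
    ring
  have hclosed : ∀ x, H x = h → IsClosedFormAt (TwoForm.pullback Φ Ω') x := fun x hx =>
    hΩ'.isClosedFormAt_pullback Φ.open_source Φ.contMDiffOn_toFun (hsource hx)
  refine ⟨a₁, a₂, ha₁, ha₂, fun x => levelPolynomial (TwoForm.pullback Φ Ω') Ω a x.1,
    fun x => degree_levelPolynomial hΩ (hv.ne_zero (hh x.1 x.2))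
      (hv.contraction_eq (hcon x.1 x.2)),
    fun x b => ⟨hΩ.pfaffian_ne_zero x.1 b, fun t => ?_⟩,
    isIntegralOn_eval_levelPolynomial hΩ hH hv hh hclosed hcon,
    isIntegralOn_coeff_levelPolynomial hΩ hH hv hh hclosed hcon⟩
  rw [← ha x]
  exact pfaffian_sub_smul_eq_levelPolynomial hΩ (hv.ne_zero (hh x.1 x.2))
    (hv.contraction_eq (hcon x.1 x.2)) b t
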